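/- **Notation.** For a group $G$, a subgroup $\Gamma$ and a submonoid $\Delta$ with $\Gamma\subseteq\Delta\subseteq G$ and $\Delta$ contained in the commensurator of $\Gamma$, the Hecke ring with respect to $(\Gamma,\Delta)$ is the free abelian group on the double cosets $\Gamma\alpha\Gamma$ ($\alpha\in\Delta$) with the product $$(\Gamma\alpha\Gamma)(\Gamma\beta\Gamma)=\sum_{\Gamma\xi\Gamma\in\Gamma\backslash\Delta/\Gamma}\bigl|\{\Gamma\gamma\in\Gamma\backslash\Gamma\beta\Gamma : \xi\gamma^{-1}\in\Gamma\alpha\Gamma\}\bigr|\;\Gamma\xi\Gamma .$$ Let $\mathcal H=L_2/[L_2,[L_2,L_2]]$ be the Heisenberg Lie algebra over $\mathbb Z$, where $L_2$ is the free Lie algebra over $\mathbb Z$ on two generators. Automorphisms act from the right. Put $$\Gamma=\mathrm{Aut}_{\mathbb Z}(\mathcal H),\qquad \Delta=\mathrm{End}_{\mathbb Z}(\mathcal H)\cap \mathrm{Aut}_{\mathbb Q}(\mathcal H\otimes\mathbb Q),$$ and for each prime $p$ $$\Gamma_p=\mathrm{Aut}_{\mathbb Z_p}(\mathcal H\otimes\mathbb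 Z_p),\qquad \Delta_p=\mathrm{End}_{\mathbb Z_p}(\mathcal H\otimes\mathbb Z_p)\cap \mathrm{Aut}_{\mathbb Q_p}(\mathcal H\otimes\mathbb Q_p),$$ where all endomorphisms and automorphisms are those of Lie algebras. Let $\widehat\Gamma=\prod_p\Gamma_p$, and let $\widehat\Delta$ be the set of $(\alpha_p)_p\in\prod_p\Delta_p$ with $\alpha_p\in\Gamma_p$ for almost all $p$. Let $R_{\mathcal H}$, $R_{\mathcal H_p}$ and $\widehat R_{\mathcal H}$ be the Hecke rings with respect to $(\Gamma,\Delta)$, $(\Gamma_p,\Delta_p)$ and $(\widehat\Gamma,\widehat\Delta)$. Let $\iota_p:R_{\mathcal H_p}\to\widehat R_{\mathcal H}$ be the additive map $\Gamma_p\alpha\Gamma_p\mapsto\widehat\Gamma\alpha\widehat\Gamma$ given by the inclusion $\Delta_p\subseteq\widehat\Delta$ (with component $1$ at all primes other than $p$). Let $\eta:\Delta\to\widehat\Delta$ be the diagonal embedding, and let $\eta_{\mathcal H}^*:\widehat R_{\mathcal H}\to R_{\mathcal H}$ be the additive map $$\widehat\Gamma\widehat\alpha\widehat\Gamma\;\mapsto\;\sum_{\Gamma\beta\Gamma\,\in\,\Gamma\backslash\eta^{-1}(\widehat\Gamma\widehat\alpha\widehat\Gamma)/\Gamma}\Gamma\beta\Gamma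 .$$ **Theorem.** 1. For each prime $p$, the map $\eta_{\mathcal H}^*\circ\iota_p:R_{\mathcal H_p}\to R_{\mathcal H}$ is an injective (unital) ring homomorphism. 2. The images of the local Hecke rings commute with each other in $R_{\mathcal H}$: for distinct primes $p\neq q$, every element of the image of $R_{\mathcal H_p}$ commutes with every element of the image of $R_{\mathcal H_q}$. 3. $R_{\mathcal H}$ is not generated as a ring by the images of the local Hecke rings $R_{\mathcal H_p}$, where $p$ runs over all primes. -/

import Mathlib

open scoped TensorProduct Pointwise

noncomputable section

namespace HeckePair

variable {G : Type*} [Group G]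

/-- The set `H \ G` of cosets `H g`. -/
abbrev Cosets (H : Subgroup G) : Type _ := Quotient (QuotientGroup.rightRel H)

/-- The convolution `(φ * ψ)(ξ) = ∑_{Hγ ∈ H \ G} φ(ξ γ⁻¹) ψ(γ)`. -/
def conv (H : Subgroup G) (φ ψ : G → ℤ) (ξ : G) : ℤ :=
  ∑ᶠ c : Cosets H, φ (ξ * c.out⁻¹) * ψ c.out

/-- `H`-bi-invariant functions supported on finitely many cosets `H g`, all contained in `Δ`. -/
structure IsHeckeFun (Δ : Submonoid G) (H : Subgroup G) (φ : G → ℤ) : Prop where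
  left_inv : ∀ a ∈ H, ∀ x, φ (a * x) = φ x
  right_inv : ∀ a ∈ H, ∀ x, φ (x * a) = φ x
  finite : {c : Cosets H | φ c.out ≠ 0}.Finite
  supp : ∀ x, φ x ≠ 0 → x ∈ Δ

variable {Δ : Submonoid G} {H : Subgroup G}

lemma out_mk (H : Subgroup G) (x : G) :
    ∃ a ∈ H, (Quotient.mk (QuotientGroup.rightRel H) x).out = a * x := by
  have h := Quotient.exact (Quotient.out_eq (Quotient.mk (QuotientGroup.rightRel H) x))
  have h' := QuotientGroup.rightRel_apply.1 h
  refine ⟨_, H.inv_mem h', ?_⟩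
  group

lemma mk_mul (a : G) (ha : a ∈ H) (x : G) :
    Quotient.mk (QuotientGroup.rightRel H) (a * x) = Quotient.mk (QuotientGroup.rightRel H) x := by
  apply Quotient.sound
  refine QuotientGroup.rightRel_apply.2 ?_
  simpa using H.inv_mem ha

/-- Right translation of cosets, `H x ↦ H x g`. -/
def translate (H : Subgroup G) (g : G) : Cosets H ≃ Cosets H where
  toFun := Quotient.map (· * g) (by
    intro x y h
    have h' := QuotientGroup.rightRel_apply.1 h
    exact QuotientGroup.rightRel_apply.2 (by simpa [mul_assoc] using h'))
  invFun := Quotient.map (· * g⁻¹) (by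
    intro x y h
    have h' := QuotientGroup.rightRel_apply.1 h
    exact QuotientGroup.rightRel_apply.2 (by simpa [mul_assoc] using h'))
  left_inv := by rintro ⟨x⟩; exact congrArg (Quotient.mk _) (by simp)
  right_inv := by rintro ⟨x⟩; exact congrArg (Quotient.mk _) (by simp)

lemma translate_out (H : Subgroup G) (g : G) (c : Cosets H) :
    ∃ a ∈ H, (translate H g c).out = a * (c.out * g) := by
  have : translate H g c = Quotient.mk (QuotientGroup.rightRel H) (c.out * g) := by
    conv_lhs => rw [← Quotient.out_eq c]
    rfl
  rw [this]
  exact out_mk H _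

namespace IsHeckeFun

variable {φ ψ χ : G → ℤ}

lemma out_eq (hφ : IsHeckeFun Δ H φ) (x : G) :
    φ (Quotient.mk (QuotientGroup.rightRel H) x).out = φ x := by
  obtain ⟨a, ha, h⟩ := out_mk H x
  rw [h, hφ.left_inv a ha]

lemma mul_inv_left (φ : G → ℤ) (a ξ x : G) :
    φ (ξ * (a * x)⁻¹) = φ (ξ * x⁻¹ * a⁻¹) := by
  congr 1; group

/-- The summands of a convolution only depend on the coset. -/
lemma summand_eq (hφ : IsHeckeFun Δ H φ) (hψ : IsHeckeFun Δ H ψ) {a : G} (ha : a ∈ H) (ξ x : G) :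
    φ (ξ * (a * x)⁻¹) * ψ (a * x) = φ (ξ * x⁻¹) * ψ x := by
  rw [hψ.left_inv a ha, mul_inv_left φ, hφ.right_inv _ (H.inv_mem ha)]

lemma finite_conv_summand (hψ : IsHeckeFun Δ H ψ) (φ : G → ℤ) (ξ : G) :
    (Function.support fun c : Cosets H => φ (ξ * c.out⁻¹) * ψ c.out).Finite :=
  hψ.finite.subset fun c hc => by
    simp only [Function.mem_support] at hc
    exact right_ne_zero_of_mul hc

lemma conv_eq_sum (hψ : IsHeckeFun Δ H ψ) (φ : G → ℤ) (ξ : G) :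
    conv H φ ψ ξ = ∑ c ∈ hψ.finite.toFinset, φ (ξ * c.out⁻¹) * ψ c.out := by
  apply finsum_eq_sum_of_support_subset
  intro c hc
  simp only [Function.mem_support] at hc
  simpa using right_ne_zero_of_mul hc

lemma exists_of_conv_ne_zero {ξ : G} (h : conv H φ ψ ξ ≠ 0) :
    ∃ c : Cosets H, φ (ξ * c.out⁻¹) ≠ 0 ∧ ψ c.out ≠ 0 := by
  by_contra! h'
  apply h
  have : ∀ c : Cosets H, φ (ξ * c.out⁻¹) * ψ c.out = 0 := fun c => by
    by_cases h1 : φ (ξ * c.out⁻¹) = 0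
    · simp [h1]
    · simp [h' c h1]
  simp [conv, this]

lemma conv_mem (hφ : IsHeckeFun Δ H φ) (hψ : IsHeckeFun Δ H ψ) : IsHeckeFun Δ H (conv H φ ψ) where
  left_inv a ha x := by
    simp only [conv, mul_assoc, hφ.left_inv a ha]
  right_inv a ha x := by
    unfold conv
    rw [← finsum_comp_equiv (translate H a)]
    refine finsum_congr fun c => ?_
    obtain ⟨b, hb, h⟩ := translate_out H a c
    rw [h, hφ.summand_eq hψ hb, hψ.right_inv a ha]
    congr 2
    group
  finite := by
    refine ((hφ.finite.prod hψ.finite).image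
      (fun q => Quotient.mk (QuotientGroup.rightRel H) (q.1.out * q.2.out))).subset ?_
    intro e he
    obtain ⟨c, h1, h2⟩ := exists_of_conv_ne_zero he
    refine ⟨(Quotient.mk _ (e.out * c.out⁻¹), c), ⟨?_, h2⟩, ?_⟩
    · show φ _ ≠ 0
      rwa [hφ.out_eq]
    · obtain ⟨a, ha, h⟩ := out_mk H (e.out * c.out⁻¹)
      simp only [h]
      conv_rhs => rw [← Quotient.out_eq e]
      rw [← mk_mul a ha e.out]
      congr 1
      group
  supp x hx := by
    obtain ⟨c, h1, h2⟩ := exists_of_conv_ne_zero hx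
    simpa using Δ.mul_mem (hφ.supp _ h1) (hψ.supp _ h2)

lemma conv_assoc (hφ : IsHeckeFun Δ H φ) (hψ : IsHeckeFun Δ H ψ) (hχ : IsHeckeFun Δ H χ) :
    conv H (conv H φ ψ) χ = conv H φ (conv H ψ χ) := by
  funext ξ
  have hR : conv H φ (conv H ψ χ) ξ = ∑ᶠ e : Cosets H, ∑ c ∈ hχ.finite.toFinset,
      φ (ξ * e.out⁻¹) * ψ (e.out * c.out⁻¹) * χ c.out := by
    refine finsum_congr fun e => ?_
    rw [hχ.conv_eq_sum, Finset.mul_sum]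
    exact Finset.sum_congr rfl fun c _ => by ring
  rw [hχ.conv_eq_sum, hR, finsum_sum_comm]
  · refine Finset.sum_congr rfl fun c _ => ?_
    rw [← finsum_mul, ← finsum_comp_equiv (translate H c.out)]
    · congr 1
      refine finsum_congr fun d => ?_
      obtain ⟨b, hb, h⟩ := translate_out H c.out d
      rw [h, mul_inv_left φ, hφ.right_inv _ (H.inv_mem hb)]
      rw [show b * (d.out * c.out) * c.out⁻¹ = b * d.out by group, hψ.left_inv b hb]
      congr 2
      group
  · intro c _
    refine (hψ.finite.preimage (translate H c.out⁻¹).injective.injOn).subset ?_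
    intro e he
    obtain ⟨b, hb, h⟩ := translate_out H c.out⁻¹ e
    show ψ _ ≠ 0
    rw [h, hψ.left_inv b hb]
    exact right_ne_zero_of_mul (left_ne_zero_of_mul he)

lemma conv_add (φ : G → ℤ) (hψ : IsHeckeFun Δ H ψ) (hχ : IsHeckeFun Δ H χ) :
    conv H φ (ψ + χ) = conv H φ ψ + conv H φ χ := by
  funext ξ
  simp only [conv, Pi.add_apply, mul_add]
  exact finsum_add_distrib (hψ.finite_conv_summand φ ξ) (hχ.finite_conv_summand φ ξ)

lemma add_conv (φ ψ : G → ℤ) (hχ : IsHeckeFun Δ H χ) :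
    conv H (φ + ψ) χ = conv H φ χ + conv H ψ χ := by
  funext ξ
  simp only [conv, Pi.add_apply, add_mul]
  exact finsum_add_distrib (hχ.finite_conv_summand φ ξ) (hχ.finite_conv_summand ψ ξ)

end IsHeckeFun

/-- An element of the Hecke module as a function on `G`, extended by zero outside `Δ`. -/
def toFun (f : HeckeRing Δ H ℤ) (x : G) : ℤ :=
  open Classical in if h : x ∈ Δ then f (HeckeCoset.mk H H ⟨x, h⟩) else 0

lemma toFun_coe (f : HeckeRing Δ H ℤ) (x : Δ) : toFun f x = f (HeckeCoset.mk H H x) := by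
  simp [toFun]

lemma mk_eq_mk {x y : Δ} : HeckeCoset.mk H H x = HeckeCoset.mk H H y ↔
    ∃ a ∈ H, ∃ b ∈ H, (y : G) = a * x * b :=
  Quotient.eq.trans DoubleCoset.rel_iff

/-- A double coset `H β H` with `β` in the commensurator of `H` is a finite union of cosets
`H g`. -/
lemma finite_cosets {β : G} (hβ : β ∈ Subgroup.Commensurable.commensurator H) :
    {c : Cosets H | ∃ a ∈ H, ∃ b ∈ H, c.out = a * β * b}.Finite := by
  have h1 := (Subgroup.Commensurable.commensurator_mem_iff H β⁻¹).1
    ((Subgroup.Commensurable.commensurator H).inv_mem hβ)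
  have hfi : ((ConjAct.toConjAct β⁻¹ • H).subgroupOf H).FiniteIndex := ⟨h1.1⟩
  have hfin : Finite (H ⧸ (ConjAct.toConjAct β⁻¹ • H).subgroupOf H) :=
    Subgroup.finite_quotient_of_finiteIndex
  let F : (H ⧸ (ConjAct.toConjAct β⁻¹ • H).subgroupOf H) → Cosets H :=
    Quotient.lift (fun b : H => Quotient.mk (QuotientGroup.rightRel H) (β * (b : G)⁻¹)) (by
      intro x y hxy
      have h2 := QuotientGroup.leftRel_apply.1 hxy
      rw [Subgroup.mem_subgroupOf, Subgroup.mem_pointwise_smul_iff_inv_smul_mem] at h2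
      have h3 := H.inv_mem h2
      refine Quotient.sound (QuotientGroup.rightRel_apply.2 ?_)
      simp only [ConjAct.smul_def, ← ConjAct.toConjAct_inv, ConjAct.ofConjAct_toConjAct] at h3
      simpa [mul_assoc] using h3)
  refine (Set.finite_range F).subset ?_
  rintro c ⟨a, ha, b, hb, h⟩
  refine ⟨Quotient.mk _ ⟨b⁻¹, H.inv_mem hb⟩, ?_⟩
  rw [← Quotient.out_eq c, h, mul_assoc, mk_mul a ha]
  show Quotient.mk _ (β * (b⁻¹)⁻¹) = _
  rw [inv_inv]

/-- A bi-invariant function as a finite formal sum of double cosets. -/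
def ofFun (φ : G → ℤ) (hφ : IsHeckeFun Δ H φ) : HeckeRing Δ H ℤ :=
  HeckeCosetModule.of <| Finsupp.ofSupportFinite
    (fun D : HeckeCoset Δ H H => φ ((Quotient.out D : Δ) : G)) (by
      refine Set.Finite.of_finite_image (f := fun D : HeckeCoset Δ H H =>
        Quotient.mk (QuotientGroup.rightRel H) ((Quotient.out D : Δ) : G)) ?_ ?_
      · refine hφ.finite.subset ?_
        rintro _ ⟨D, hD, rfl⟩
        show φ _ ≠ 0
        rw [hφ.out_eq]
        exact hD
      · intro D _ E _ h
        rw [← Quotient.out_eq D, ← Quotient.out_eq E]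
        have h' := QuotientGroup.rightRel_apply.1 (Quotient.exact h)
        exact mk_eq_mk.2 ⟨_, h', 1, H.one_mem, by simp⟩)

lemma ofFun_mk (φ : G → ℤ) (hφ : IsHeckeFun Δ H φ) (x : Δ) :
    ofFun φ hφ (HeckeCoset.mk H H x) = φ x := by
  obtain ⟨a, ha, b, hb, h⟩ := mk_eq_mk.1 (Quotient.out_eq (HeckeCoset.mk H H x)).symm
  show φ _ = φ x
  rw [h, hφ.right_inv b hb, hφ.left_inv a ha]

lemma toFun_ofFun (φ : G → ℤ) (hφ : IsHeckeFun Δ H φ) : toFun (ofFun φ hφ) = φ := by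
  funext x
  by_cases hx : x ∈ Δ
  · exact (toFun_coe (ofFun φ hφ) ⟨x, hx⟩).trans (ofFun_mk φ hφ ⟨x, hx⟩)
  · have : φ x = 0 := by
      by_contra h
      exact hx (hφ.supp x h)
    simp [toFun, hx, this]

lemma toFun_injective : Function.Injective (toFun : HeckeRing Δ H ℤ → G → ℤ) := by
  intro f g h
  refine HeckeCosetModule.ext fun D => ?_
  obtain ⟨x, rfl⟩ := Quotient.exists_rep D
  exact (toFun_coe f x).symm.trans ((congrFun h x).trans (toFun_coe g x))

lemma toFun_add (f g : HeckeRing Δ H ℤ) : toFun (f + g) = toFun f + toFun g := by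
  funext x
  by_cases hx : x ∈ Δ
  · simp only [toFun, hx, dite_true, Pi.add_apply]
    rfl
  · simp [toFun, hx]

lemma toFun_zero : toFun (0 : HeckeRing Δ H ℤ) = fun _ => 0 := by
  funext x
  by_cases hx : x ∈ Δ
  · simp only [toFun, hx, dite_true]
    rfl
  · simp [toFun, hx]

section Ring

variable [IsHeckeTriple Δ H H]

lemma isHeckeFun_toFun (f : HeckeRing Δ H ℤ) : IsHeckeFun Δ H (toFun f) := by
  have hH : ∀ a ∈ H, a ∈ Δ := fun a ha => IsHeckeTriple.mem_of_mem_left H ha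
  have key : ∀ a ∈ H, ∀ b ∈ H, ∀ x, toFun f (a * x * b) = toFun f x := by
    intro a ha b hb x
    by_cases hx : x ∈ Δ
    · have hx' : a * x * b ∈ Δ := Δ.mul_mem (Δ.mul_mem (hH a ha) hx) (hH b hb)
      simp only [toFun, hx, hx', dite_true]
      congr 1
      exact (mk_eq_mk.2 ⟨a, ha, b, hb, rfl⟩).symm
    · have hx' : a * x * b ∉ Δ := fun h => hx (by
        simpa [mul_assoc] using
          Δ.mul_mem (Δ.mul_mem (hH _ (H.inv_mem ha)) h) (hH _ (H.inv_mem hb)))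
      simp [toFun, hx, hx']
  refine ⟨fun a ha x => by simpa using key a ha 1 H.one_mem x,
    fun a ha x => by simpa using key 1 H.one_mem a ha x, ?_, ?_⟩
  · have : (⋃ D ∈ {D : HeckeCoset Δ H H | f D ≠ 0},
        {c : Cosets H | ∃ a ∈ H, ∃ b ∈ H, c.out = a * ((Quotient.out D : Δ) : G) * b}).Finite := by
      refine Set.Finite.biUnion (HeckeCosetModule.of.symm f).hasFiniteSupport fun D _ => ?_
      exact finite_cosets (IsHeckeTriple.mem_commensurator_right H (Quotient.out D : Δ))
    refine this.subset fun c hc => ?_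
    have hΔ : c.out ∈ Δ := by
      by_contra h
      exact hc (by simp [toFun, h])
    have hne : f (HeckeCoset.mk H H ⟨c.out, hΔ⟩) ≠ 0 := by
      simpa [toFun, hΔ] using hc
    refine Set.mem_biUnion hne ?_
    exact mk_eq_mk.1 (Quotient.out_eq (HeckeCoset.mk H H ⟨c.out, hΔ⟩))
  · intro x hx
    by_contra h
    exact hx (by simp [toFun, h])

/-- The product of the Hecke ring: the coefficient of `HξH` in `f * g` is
`∑_{Hγ ∈ H \ G} f(H ξγ⁻¹ H) g(H γ H)`, a term being zero if `ξγ⁻¹` or `γ` is not in `Δ`.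
This is the bilinear extension of
`HαH * HβH = ∑_ξ #{Hγ ⊆ HβH | ξγ⁻¹ ∈ HαH} HξH`; see `basis_mul_basis`. -/
instance instMul : Mul (HeckeRing Δ H ℤ) where
  mul f g := ofFun (conv H (toFun f) (toFun g)) ((isHeckeFun_toFun f).conv_mem (isHeckeFun_toFun g))

/-- The identity of the Hecke ring is the double coset `H1H = H`. -/
instance instOne : One (HeckeRing Δ H ℤ) where
  one := HeckeCosetModule.of (Finsupp.single 1 1)

lemma toFun_mul (f g : HeckeRing Δ H ℤ) : toFun (f * g) = conv H (toFun f) (toFun g) :=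
  toFun_ofFun _ _

/-- The double coset `HαH` as an element of the Hecke ring. -/
def basis (H : Subgroup G) (α : Δ) : HeckeRing Δ H ℤ :=
  HeckeCosetModule.of (Finsupp.single (HeckeCoset.mk H H α) 1)

open Classical in
lemma toFun_basis (α : Δ) (x : G) :
    toFun (basis H α) x = if x ∈ DoubleCoset.doubleCoset (α : G) H H then 1 else 0 := by
  by_cases hx : x ∈ Δ
  · rw [toFun_coe (basis H α) ⟨x, hx⟩]
    have : HeckeCoset.mk H H α = HeckeCoset.mk H H ⟨x, hx⟩ ↔
        x ∈ DoubleCoset.doubleCoset (α : G) H H := mk_eq_mk.trans DoubleCoset.mem_doubleCoset.symm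
    show (Finsupp.single (HeckeCoset.mk H H α) (1 : ℤ)) (HeckeCoset.mk H H ⟨x, hx⟩) = _
    rw [Finsupp.single_apply, if_congr this rfl rfl]
  · have : x ∉ DoubleCoset.doubleCoset (α : G) H H := by
      rw [DoubleCoset.mem_doubleCoset]
      rintro ⟨a, ha, b, hb, rfl⟩
      exact hx (Δ.mul_mem (Δ.mul_mem (IsHeckeTriple.mem_of_mem_left H ha) α.2)
        (IsHeckeTriple.mem_of_mem_left H hb))
    simp [toFun, hx, this]

open Classical in
lemma toFun_one (x : G) : toFun (1 : HeckeRing Δ H ℤ) x = if x ∈ H then 1 else 0 := by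
  refine (toFun_basis (1 : Δ) x).trans (if_congr ?_ rfl rfl)
  rw [DoubleCoset.mem_doubleCoset]
  constructor
  · rintro ⟨a, ha, b, hb, rfl⟩
    simpa using H.mul_mem ha hb
  · intro hx
    exact ⟨x, hx, 1, H.one_mem, by simp⟩

lemma conv_one (f : HeckeRing Δ H ℤ) :
    conv H (toFun f) (toFun (1 : HeckeRing Δ H ℤ)) = toFun f := by
  classical
  funext ξ
  unfold conv
  rw [finsum_eq_single _ (Quotient.mk (QuotientGroup.rightRel H) 1)]
  · obtain ⟨a, ha, h⟩ := out_mk H 1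
    rw [h, (isHeckeFun_toFun f).summand_eq (isHeckeFun_toFun 1) ha]
    simp [toFun_one, H.one_mem]
  · intro c hc
    have : c.out ∉ H := fun h => hc (by
      have := mk_mul c.out h 1
      rwa [mul_one, Quotient.out_eq] at this)
    simp [toFun_one, this]

lemma one_conv (f : HeckeRing Δ H ℤ) :
    conv H (toFun (1 : HeckeRing Δ H ℤ)) (toFun f) = toFun f := by
  classical
  funext ξ
  unfold conv
  rw [finsum_eq_single _ (Quotient.mk (QuotientGroup.rightRel H) ξ)]
  · obtain ⟨a, ha, h⟩ := out_mk H ξ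
    rw [h, (isHeckeFun_toFun 1).summand_eq (isHeckeFun_toFun f) ha]
    simp [toFun_one, H.one_mem]
  · intro c hc
    have : ξ * c.out⁻¹ ∉ H := fun h => hc (by
      have := mk_mul _ h c.out
      rw [inv_mul_cancel_right, Quotient.out_eq] at this
      exact this.symm)
    simp [toFun_one, this]

instance instRing : Ring (HeckeRing Δ H ℤ) :=
  { (inferInstance : AddCommGroup (HeckeRing Δ H ℤ)), instMul, instOne with
    left_distrib := fun f g h => toFun_injective (by
      simp only [toFun_mul, toFun_add]
      exact IsHeckeFun.conv_add _ (isHeckeFun_toFun g) (isHeckeFun_toFun h))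
    right_distrib := fun f g h => toFun_injective (by
      simp only [toFun_mul, toFun_add]
      exact IsHeckeFun.add_conv _ _ (isHeckeFun_toFun h))
    zero_mul := fun f => toFun_injective (by
      rw [toFun_mul, toFun_zero]
      funext ξ
      simp [conv])
    mul_zero := fun f => toFun_injective (by
      rw [toFun_mul, toFun_zero]
      funext ξ
      simp [conv])
    mul_assoc := fun f g h => toFun_injective (by
      simp only [toFun_mul]
      exact (isHeckeFun_toFun f).conv_assoc (isHeckeFun_toFun g) (isHeckeFun_toFun h))
    one_mul := fun f => toFun_injective (by rw [toFun_mul, one_conv])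
    mul_one := fun f => toFun_injective (by rw [toFun_mul, conv_one]) }

/-- The structure constants of the Hecke ring. -/
lemma basis_mul_basis (α β ξ : Δ) :
    (basis H α * basis H β) (HeckeCoset.mk H H ξ) =
      Nat.card {c : Cosets H // c.out ∈ DoubleCoset.doubleCoset (β : G) H H ∧
        (ξ : G) * c.out⁻¹ ∈ DoubleCoset.doubleCoset (α : G) H H} := by
  classical
  rw [← toFun_coe, toFun_mul]
  unfold conv
  rw [finsum_congr (g := fun c : Cosets H =>
    if c.out ∈ DoubleCoset.doubleCoset (β : G) H H ∧
        (ξ : G) * c.out⁻¹ ∈ DoubleCoset.doubleCoset (α : G) H H then (1 : ℤ) else 0)]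
  · have hfin : {c : Cosets H | c.out ∈ DoubleCoset.doubleCoset (β : G) H H ∧
        (ξ : G) * c.out⁻¹ ∈ DoubleCoset.doubleCoset (α : G) H H}.Finite := by
      refine (isHeckeFun_toFun (basis H β)).finite.subset fun c hc => ?_
      show toFun _ _ ≠ 0
      rw [toFun_basis, if_pos hc.1]
      exact one_ne_zero
    rw [finsum_eq_sum_of_support_subset (s := hfin.toFinset)]
    · rw [Finset.sum_ite_of_true (by intro c hc; simpa using hc)]
      simp only [Finset.sum_const, nsmul_eq_mul, mul_one, Nat.cast_inj]
      exact (Nat.card_eq_card_finite_toFinset hfin).symm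
    · intro c hc
      simpa using hc
  · intro c
    rw [toFun_basis, toFun_basis]
    by_cases h1 : c.out ∈ DoubleCoset.doubleCoset (β : G) H H <;>
    by_cases h2 : (ξ : G) * c.out⁻¹ ∈ DoubleCoset.doubleCoset (α : G) H H <;> simp [h1, h2]

end Ring

end HeckePair

/-- The automorphism group of a Lie algebra `V` over `K`, acting on `V` from the right:
`x ^ (g h) = (x ^ g) ^ h`, i.e. products are compositions read from left to right. -/
structure LieAut (K V : Type*) [CommRing K] [LieRing V] [LieAlgebra K V] where
  /-- The underlying automorphism. -/
  toLieEquiv : V ≃ₗ⁅K⁆ V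

namespace LieAut

section
variable {K V : Type*} [CommRing K] [LieRing V] [LieAlgebra K V]

instance : FunLike (LieAut K V) V V where
  coe g := g.toLieEquiv
  coe_injective := by
    rintro ⟨g⟩ ⟨h⟩ e
    congr
    exact DFunLike.coe_injective e

@[ext] lemma ext {g h : LieAut K V} (e : ∀ x, g x = h x) : g = h := DFunLike.ext _ _ e

instance : Group (LieAut K V) where
  mul g h := ⟨g.toLieEquiv.trans h.toLieEquiv⟩
  one := ⟨LieEquiv.refl⟩
  inv g := ⟨g.toLieEquiv.symm⟩
  mul_assoc _ _ _ := rfl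
  one_mul _ := rfl
  mul_one _ := rfl
  inv_mul_cancel g := ext fun x => g.toLieEquiv.apply_symm_apply x

lemma mul_apply (g h : LieAut K V) (x : V) : (g * h) x = h (g x) := rfl
lemma one_apply (x : V) : (1 : LieAut K V) x = x := rfl
lemma inv_apply_self (g : LieAut K V) (x : V) : g⁻¹ (g x) = x := g.toLieEquiv.symm_apply_apply x
lemma apply_inv_self (g : LieAut K V) (x : V) : g (g⁻¹ x) = x := g.toLieEquiv.apply_symm_apply x

end

section
variable (R K L : Type*) [CommRing R] [CommRing K] [Algebra R K] [LieRing L]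

/-- The image of `R ⊗ L` in `K ⊗ L`: the `R`-span of the elements `1 ⊗ x`. -/
def lattice : Submodule R (K ⊗[ℤ] L) :=
  Submodule.span R (Set.range fun x : L => (1 : K) ⊗ₜ[ℤ] x)

/-- `End_R(R ⊗ L) ∩ Aut_K(K ⊗ L)`: the automorphisms of `K ⊗ L` that map `R ⊗ L` into itself. -/
def Delta : Submonoid (LieAut K (K ⊗[ℤ] L)) where
  carrier := {g | ∀ x ∈ lattice R K L, g x ∈ lattice R K L}
  one_mem' := fun _ hx => hx
  mul_mem' := fun hg hh x hx => hh _ (hg x hx)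

/-- `Aut_R(R ⊗ L)`: the automorphisms of `K ⊗ L` that map `R ⊗ L` onto itself. -/
def Gamma : Subgroup (LieAut K (K ⊗[ℤ] L)) where
  carrier := {g | g ∈ Delta R K L ∧ g⁻¹ ∈ Delta R K L}
  one_mem' := ⟨one_mem _, by simp⟩
  mul_mem' := fun hg hh => ⟨mul_mem hg.1 hh.1, by simpa using mul_mem hh.2 hg.2⟩
  inv_mem' := fun hg => ⟨hg.2, by simpa using hg.1⟩

end

section
variable {K L : Type*} [CommRing K] [LieRing L]
variable (K' : Type*) [CommRing K'] [Algebra K K']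

lemma smul_lie_smul {K V : Type*} [CommRing K] [LieRing V] [LieAlgebra K V] (a b : K) (v w : V) :
    ⁅a • v, b • w⁆ = (a * b) • ⁅v, w⁆ := by
  rw [smul_lie, lie_smul, smul_smul]

/-- The natural map `K ⊗ L → K' ⊗ L`. -/
def scalarMap (K K' L : Type*) [CommRing K] [CommRing K'] [Algebra K K'] [LieRing L] :
    K ⊗[ℤ] L →ₗ⁅ℤ⁆ K' ⊗[ℤ] L :=
  LieAlgebra.ExtendScalars.map (Algebra.ofId K K' |>.restrictScalars ℤ) (LieHom.id)

/-- Extension of scalars of an automorphism of `K ⊗ L` to `K' ⊗ L`. -/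
def extendLinear (g : K ⊗[ℤ] L ≃ₗ[K] K ⊗[ℤ] L) : K' ⊗[ℤ] L ≃ₗ[K'] K' ⊗[ℤ] L :=
  (TensorProduct.AlgebraTensorModule.cancelBaseChange ℤ K K' K' L).symm ≪≫ₗ
    g.baseChange K K' _ _ ≪≫ₗ
      TensorProduct.AlgebraTensorModule.cancelBaseChange ℤ K K' K' L

lemma scalarMap_tmul (a : K) (x : L) :
    scalarMap K K' L (a ⊗ₜ[ℤ] x) = algebraMap K K' a ⊗ₜ[ℤ] x := rfl

lemma scalarMap_smul (a : K) (v : K ⊗[ℤ] L) :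
    scalarMap K K' L (a • v) = algebraMap K K' a • scalarMap K K' L v := by
  induction v with
  | zero => simp
  | tmul b x =>
    rw [TensorProduct.smul_tmul', scalarMap_tmul, scalarMap_tmul, TensorProduct.smul_tmul',
      smul_eq_mul, smul_eq_mul, map_mul]
  | add v w hv hw => simp only [smul_add, map_add, hv, hw]

lemma cancelBaseChange_tmul (a : K') (v : K ⊗[ℤ] L) :
    TensorProduct.AlgebraTensorModule.cancelBaseChange ℤ K K' K' L (a ⊗ₜ[K] v) =
      a • scalarMap K K' L v := by
  induction v with
  | zero => simp
  | tmul b x =>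
    simp [TensorProduct.smul_tmul', scalarMap_tmul, Algebra.smul_def, mul_comm]
  | add v w hv hw => simp only [TensorProduct.tmul_add, smul_add, map_add, hv, hw]

lemma extendLinear_tmul (g : K ⊗[ℤ] L ≃ₗ[K] K ⊗[ℤ] L) (a : K') (x : L) :
    extendLinear K' g (a ⊗ₜ x) = a • scalarMap K K' L (g (1 ⊗ₜ x)) := by
  simp [extendLinear, cancelBaseChange_tmul]

lemma extendLinear_scalarMap (g : K ⊗[ℤ] L ≃ₗ[K] K ⊗[ℤ] L) (v : K ⊗[ℤ] L) :
    extendLinear K' g (scalarMap K K' L v) = scalarMap K K' L (g v) := by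
  induction v with
  | zero => simp
  | tmul b x =>
    rw [scalarMap_tmul, extendLinear_tmul, ← scalarMap_smul, ← map_smul,
      TensorProduct.smul_tmul', smul_eq_mul, mul_one]
  | add v w hv hw => simp only [map_add, hv, hw]

lemma extendLinear_lie (g : K ⊗[ℤ] L ≃ₗ⁅K⁆ K ⊗[ℤ] L) (v w : K' ⊗[ℤ] L) :
    extendLinear K' g.toLinearEquiv ⁅v, w⁆ =
      ⁅extendLinear K' g.toLinearEquiv v, extendLinear K' g.toLinearEquiv w⁆ := by
  induction v with
  | zero => simp
  | add v v' hv hv' => simp only [add_lie, map_add, hv, hv']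
  | tmul a x =>
    induction w with
    | zero =>
      rw [map_zero]
      exact (congrArg _ (lie_zero (a ⊗ₜ[ℤ] x))).trans ((map_zero _).trans (lie_zero (extendLinear K' g.toLinearEquiv (a ⊗ₜ[ℤ] x))).symm)
    | add w w' hw hw' =>
      rw [map_add]
      refine (congrArg _ (lie_add (a ⊗ₜ[ℤ] x) w w')).trans ((map_add _ _ _).trans ?_)
      rw [hw, hw']
      exact (lie_add (extendLinear K' g.toLinearEquiv (a ⊗ₜ[ℤ] x)) _ _).symm
    | tmul b y =>
      have h : (1 : K) ⊗ₜ[ℤ] ⁅x, y⁆ = ⁅(1 : K) ⊗ₜ[ℤ] x, (1 : K) ⊗ₜ[ℤ] y⁆ := by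
        rw [LieAlgebra.ExtendScalars.bracket_tmul, mul_one]
      rw [LieAlgebra.ExtendScalars.bracket_tmul, extendLinear_tmul, extendLinear_tmul,
        extendLinear_tmul, h, LieEquiv.coe_toLinearEquiv, LieEquiv.map_lie, LieHom.map_lie]
      exact (smul_lie_smul a b _ _).symm

/-- Extension of scalars `Aut_K(K ⊗ L) → Aut_K'(K' ⊗ L)`. -/
def extendScalars : LieAut K (K ⊗[ℤ] L) →* LieAut K' (K' ⊗[ℤ] L) where
  toFun g := ⟨{ extendLinear K' g.toLieEquiv.toLinearEquiv with
    map_lie' := fun {v w} => extendLinear_lie K' g.toLieEquiv v w }⟩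
  map_one' := by
    ext v
    show extendLinear K' _ v = v
    induction v with
    | zero => simp
    | add v w hv hw => simp only [map_add, hv, hw]
    | tmul a x =>
      rw [extendLinear_tmul]
      show a • scalarMap K K' L (1 ⊗ₜ x) = _
      simp [scalarMap_tmul, TensorProduct.smul_tmul']
  map_mul' g h := by
    ext v
    show extendLinear K' _ v = extendLinear K' _ (extendLinear K' _ v)
    induction v with
    | zero => simp
    | add v w hv hw => simp only [map_add, hv, hw]
    | tmul a x =>
      rw [extendLinear_tmul, extendLinear_tmul, map_smul, extendLinear_scalarMap]
      rfl

end

section Commensurable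

lemma index_ne_zero_of_map {G T : Type*} [Group G] [Finite T] (S : Subgroup G) (F : G → T)
    (h : ∀ a b, F a = F b → a⁻¹ * b ∈ S) : S.index ≠ 0 := by
  have : Finite (G ⧸ S) := by
    refine Finite.of_injective (fun q : G ⧸ S => F q.out) fun q r e => ?_
    have := QuotientGroup.eq.2 (h _ _ e)
    rwa [QuotientGroup.out_eq', QuotientGroup.out_eq'] at this
  exact (Subgroup.finiteIndex_of_finite_quotient (H := S)).index_ne_zero

lemma mem_conj_iff {G : Type*} [Group G] (S : Subgroup G) (g u : G) :
    u ∈ ConjAct.toConjAct g • S ↔ g⁻¹ * u * g ∈ S := by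
  rw [Subgroup.mem_pointwise_smul_iff_inv_smul_mem, ← ConjAct.toConjAct_inv, ConjAct.smul_def]
  simp

lemma commensurable_of_relIndex {G : Type*} [Group G] (S : Subgroup G) (g : G)
    (h : ∀ x ∈ ({g, g⁻¹} : Set G), (ConjAct.toConjAct x • S).relIndex S ≠ 0) :
    g ∈ Subgroup.Commensurable.commensurator S := by
  rw [Subgroup.Commensurable.commensurator_mem_iff]
  refine ⟨h g (by simp), ?_⟩
  have := h g⁻¹ (by simp)
  rwa [← Subgroup.relIndex_pointwise_smul (ConjAct.toConjAct g), smul_smul,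
    ← ConjAct.toConjAct_mul, mul_inv_cancel, ConjAct.toConjAct_one, one_smul] at this

variable (R K L : Type*) [CommRing R] [Field K] [Algebra R K] [LieRing L]

lemma lattice_fg [Module.Finite ℤ L] : (lattice R K L).FG := by
  obtain ⟨s, hs⟩ := (Module.Finite.fg_top : (⊤ : Submodule ℤ L).FG)
  classical
  refine ⟨s.image fun x => (1 : K) ⊗ₜ[ℤ] x, le_antisymm (Submodule.span_mono ?_) ?_⟩
  · intro v hv
    simp only [Finset.coe_image, Set.mem_image] at hv
    obtain ⟨x, _, rfl⟩ := hv
    exact ⟨x, rfl⟩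
  · refine Submodule.span_le.2 ?_
    rintro _ ⟨x, rfl⟩
    have hx : x ∈ Submodule.span ℤ (s : Set L) := hs ▸ Submodule.mem_top
    induction hx using Submodule.span_induction with
    | mem y hy => exact Submodule.subset_span (by simpa using ⟨y, hy, rfl⟩)
    | zero => simp
    | add y z _ _ h1 h2 =>
      simp only [TensorProduct.tmul_add]
      exact add_mem h1 h2
    | smul n y _ h =>
      simp only [TensorProduct.tmul_smul]
      exact zsmul_mem h n

variable [IsFractionRing R K]

lemma exists_smul_mem (v : K ⊗[ℤ] L) :
    ∃ n : R, n ≠ 0 ∧ n • v ∈ lattice R K L := by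
  have : IsDomain R := (IsFractionRing.injective R K).isDomain (algebraMap R K)
  induction v with
  | zero => exact ⟨1, one_ne_zero, by simp⟩
  | tmul a x =>
    obtain ⟨r, s, hs, rfl⟩ := IsFractionRing.div_surjective (A := R) a
    have hs0 : s ≠ 0 := nonZeroDivisors.ne_zero hs
    have hs1 : algebraMap R K s ≠ 0 := by
      simpa using hs0
    refine ⟨s, hs0, ?_⟩
    have : s • ((algebraMap R K r / algebraMap R K s) ⊗ₜ[ℤ] x) = r • ((1 : K) ⊗ₜ[ℤ] x) := by
      rw [TensorProduct.smul_tmul', TensorProduct.smul_tmul', Algebra.smul_def, Algebra.smul_def,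
        mul_one, mul_div_cancel₀ _ hs1]
    rw [this]
    exact Submodule.smul_mem _ _ (Submodule.subset_span ⟨x, rfl⟩)
  | add v w hv hw =>
    obtain ⟨n, hn, h1⟩ := hv
    obtain ⟨m, hm, h2⟩ := hw
    refine ⟨n * m, mul_ne_zero hn hm, ?_⟩
    rw [smul_add]
    refine add_mem ?_ ?_
    · rw [mul_comm, mul_smul]
      exact Submodule.smul_mem _ _ h1
    · rw [mul_smul]
      exact Submodule.smul_mem _ _ h2

lemma apply_smul {R K V : Type*} [CommRing R] [CommRing K] [Algebra R K] [LieRing V]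
    [LieAlgebra K V] [Module R V] [IsScalarTower R K V] (g : LieAut K V) (n : R) (v : V) :
    g (n • v) = n • g v := by
  rw [← algebraMap_smul K n v, ← algebraMap_smul K n (g v)]
  exact map_smul g.toLieEquiv _ _

lemma exists_smul_apply_mem [Module.Finite ℤ L] (g : LieAut K (K ⊗[ℤ] L)) :
    ∃ n : R, n ≠ 0 ∧ ∀ x ∈ lattice R K L, n • g x ∈ lattice R K L := by
  have : IsDomain R := (IsFractionRing.injective R K).isDomain (algebraMap R K)
  classical
  obtain ⟨s, hs⟩ := lattice_fg R K L
  choose n hn hmem using exists_smul_mem R K L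
  refine ⟨∏ v ∈ s, n (g v), Finset.prod_ne_zero_iff.2 fun v _ => hn _, fun x hx => ?_⟩
  rw [← hs] at hx
  induction hx using Submodule.span_induction with
  | mem y hy =>
    rw [← Finset.prod_erase_mul s _ hy, mul_smul]
    exact Submodule.smul_mem _ _ (hmem _)
  | zero =>
    rw [show g 0 = 0 from map_zero g.toLieEquiv, smul_zero]
    exact zero_mem _
  | add y z _ _ h1 h2 =>
    rw [show g (y + z) = g y + g z from map_add g.toLieEquiv y z, smul_add]
    exact add_mem h1 h2
  | smul r y _ h =>
    rw [apply_smul, smul_comm]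
    exact Submodule.smul_mem _ _ h

variable [Ring.HasFiniteQuotients R]

lemma relIndex_conj_ne_zero [Module.Finite ℤ L] (g : LieAut K (K ⊗[ℤ] L)) :
    (ConjAct.toConjAct g • Gamma R K L).relIndex (Gamma R K L) ≠ 0 := by
  classical
  have : IsDomain R := (IsFractionRing.injective R K).isDomain (algebraMap R K)
  obtain ⟨n, hn, h1⟩ := exists_smul_apply_mem R K L g⁻¹
  obtain ⟨m, hm, h2⟩ := exists_smul_apply_mem R K L g
  obtain ⟨s, hs⟩ := lattice_fg R K L
  have hnm : Ideal.span {n * m} ≠ ⊥ := by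
    simpa using ⟨hn, hm⟩
  have hfin : Finite (R ⧸ Ideal.span {n * m}) := Ring.HasFiniteQuotients.finiteQuotient hnm
  have hcoef : ∀ (a : Gamma R K L) (v : s), ∃ c : K ⊗[ℤ] L → R,
      ∑ w ∈ s, c w • w = a.1 v.1 := fun a v => by
    have hv : a.1 v.1 ∈ lattice R K L := a.2.1 _ (hs ▸ Submodule.subset_span v.2)
    rw [← hs, Submodule.mem_span_finset] at hv
    obtain ⟨c, _, hc⟩ := hv
    exact ⟨c, hc⟩
  choose c hc using hcoef
  -- elements with congruent coefficients agree modulo `n * m`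
  have hcong : ∀ a b : Gamma R K L,
      (∀ v w : s, Ideal.Quotient.mk (Ideal.span {n * m}) (c a v w) =
        Ideal.Quotient.mk (Ideal.span {n * m}) (c b v w)) →
      ∀ x ∈ lattice R K L, ∃ y ∈ lattice R K L, b.1 x = a.1 x + (n * m) • y := by
    intro a b hab x hx
    rw [← hs] at hx
    induction hx using Submodule.span_induction with
    | mem v hv =>
      have : ∀ w : s, ∃ d : R, c b ⟨v, hv⟩ w = c a ⟨v, hv⟩ w + (n * m) * d := fun w => by
        have := Ideal.Quotient.eq.1 (hab ⟨v, hv⟩ w).symm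
        obtain ⟨d, hd⟩ := Ideal.mem_span_singleton.1 this
        exact ⟨d, by rw [← hd]; ring⟩
      choose d hd using this
      refine ⟨∑ w : s, d w • w.1, Submodule.sum_mem _ fun w _ => Submodule.smul_mem _ _
        (hs ▸ Submodule.subset_span w.2), ?_⟩
      rw [← hc a ⟨v, hv⟩, ← hc b ⟨v, hv⟩, ← Finset.sum_coe_sort s, ← Finset.sum_coe_sort s,
        Finset.smul_sum, ← Finset.sum_add_distrib]
      refine Finset.sum_congr rfl fun w _ => ?_
      rw [hd, add_smul, mul_smul (n * m)]
    | zero =>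
      refine ⟨0, zero_mem _, ?_⟩
      rw [show a.1 0 = 0 from map_zero a.1.toLieEquiv,
        show b.1 0 = 0 from map_zero b.1.toLieEquiv]
      simp
    | add v w _ _ hv hw =>
      obtain ⟨y, hy, e1⟩ := hv
      obtain ⟨z, hz, e2⟩ := hw
      refine ⟨y + z, add_mem hy hz, ?_⟩
      rw [show a.1 (v + w) = a.1 v + a.1 w from map_add a.1.toLieEquiv v w,
        show b.1 (v + w) = b.1 v + b.1 w from map_add b.1.toLieEquiv v w, e1, e2, smul_add]
      abel
    | smul r v _ hv =>
      obtain ⟨y, hy, e1⟩ := hv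
      refine ⟨r • y, Submodule.smul_mem _ _ hy, ?_⟩
      rw [apply_smul, apply_smul, e1, smul_add, smul_comm r]
  have hmain : ∀ a b : Gamma R K L,
      (∀ v w : s, Ideal.Quotient.mk (Ideal.span {n * m}) (c a v w) =
        Ideal.Quotient.mk (Ideal.span {n * m}) (c b v w)) →
      g⁻¹ * (a.1⁻¹ * b.1) * g ∈ Delta R K L := by
    intro a b hab x hx
    show g (b.1 (a.1⁻¹ (g⁻¹ x))) ∈ _
    obtain ⟨y, hy, e⟩ := hcong a b hab (a.1⁻¹ (n • g⁻¹ x)) (a.2.2 _ (h1 x hx))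
    rw [apply_inv_self, apply_smul (R := R) a.1⁻¹, apply_smul (R := R) b.1, mul_smul, ← smul_add] at e
    have hn' : algebraMap R K n ≠ 0 := by simpa using hn
    rw [← algebraMap_smul K n, ← algebraMap_smul K n (_ + _)] at e
    have e' := smul_right_injective _ hn' e
    rw [e', show g (g⁻¹ x + m • y) = g (g⁻¹ x) + g (m • y) from map_add g.toLieEquiv _ _,
      apply_inv_self, apply_smul (R := R) g]
    exact add_mem hx (h2 y hy)
  refine index_ne_zero_of_map _ (fun a : Gamma R K L => fun v w : s =>
    Ideal.Quotient.mk (Ideal.span {n * m}) (c a v w)) fun a b hab => ?_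
  have hab' := fun v w => congrFun (congrFun hab v) w
  rw [Subgroup.mem_subgroupOf, mem_conj_iff]
  refine ⟨hmain a b hab', ?_⟩
  have := hmain b a fun v w => (hab' v w).symm
  simpa [mul_assoc] using this

end Commensurable

end LieAut

namespace LieAut

/-- `(Γ, Δ)` is a Hecke pair. -/
instance isHeckeTriple (R K L : Type*) [CommRing R] [Field K] [Algebra R K] [LieRing L]
    [IsFractionRing R K] [Ring.HasFiniteQuotients R] [Module.Finite ℤ L] :
    IsHeckeTriple (Delta R K L) (Gamma R K L) (Gamma R K L) :=
  IsHeckeTriple.of_diagonal (fun _ hg => hg.1) fun g _ =>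
    commensurable_of_relIndex _ g fun x _ => relIndex_conj_ne_zero R K L x

instance (p : Nat.Primes) : Fact (p : ℕ).Prime := ⟨p.2⟩

instance padicInt_hasFiniteQuotients (p : ℕ) [Fact p.Prime] : Ring.HasFiniteQuotients ℤ_[p] where
  finiteQuotient := by
    intro I hI
    obtain ⟨n, rfl⟩ := PadicInt.ideal_eq_span_pow_p hI
    rw [← PadicInt.ker_toZModPow n]
    have : NeZero (p ^ n) := ⟨pow_ne_zero n (Fact.out : p.Prime).ne_zero⟩
    exact Finite.of_injective _ (RingHom.kerLift_injective (PadicInt.toZModPow (p := p) n))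

section Profinite

variable (L : Type*) [LieRing L]

/-- The product of the groups `G_{L_p} = Aut(L ⊗ ℚ_p)` over all primes `p`. The restricted product
is a subgroup; it contains `GammaHat` and `DeltaHat`, and the Hecke ring only depends on these. -/
abbrev ProdGroup : Type _ := ∀ p : Nat.Primes, LieAut ℚ_[p] (ℚ_[p] ⊗[ℤ] L)

/-- `∏_p Γ_{L_p}`. -/
def GammaHat : Subgroup (ProdGroup L) where
  carrier := {g | ∀ p : Nat.Primes, g p ∈ Gamma ℤ_[p] ℚ_[p] L}
  one_mem' := fun _ => one_mem _
  mul_mem' := fun hg hh p => mul_mem (hg p) (hh p)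
  inv_mem' := fun hg p => inv_mem (hg p)

/-- The families in `∏_p Δ_{L_p}` whose components lie in `Γ_{L_p}` for almost all `p`. -/
def DeltaHat : Submonoid (ProdGroup L) where
  carrier := {g | (∀ p : Nat.Primes, g p ∈ Delta ℤ_[p] ℚ_[p] L) ∧ {p : Nat.Primes | g p ∉ Gamma ℤ_[p] ℚ_[p] L}.Finite}
  one_mem' := ⟨fun p => one_mem _, by simp [one_mem]⟩
  mul_mem' := fun {g h} hg hh => ⟨fun p => mul_mem (hg.1 p) (hh.1 p),
    (hg.2.union hh.2).subset fun p hp => by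
      by_contra hp'
      simp only [Set.mem_union, Set.mem_ofPred_eq, not_or, not_not] at hp'
      exact hp (mul_mem hp'.1 hp'.2)⟩

lemma relIndex_conj_hat_ne_zero [Module.Finite ℤ L] (g : ProdGroup L)
    (hg : {p : Nat.Primes | g p ∉ Gamma ℤ_[p] ℚ_[p] L}.Finite) :
    (ConjAct.toConjAct g • GammaHat L).relIndex (GammaHat L) ≠ 0 := by
  have hfin : Finite {p : Nat.Primes | g p ∉ Gamma ℤ_[p] ℚ_[p] L} := hg
  let S (p : Nat.Primes) : Subgroup (Gamma ℤ_[p] ℚ_[p] L) :=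
    (ConjAct.toConjAct (g p) • Gamma ℤ_[p] ℚ_[p] L).subgroupOf (Gamma ℤ_[p] ℚ_[p] L)
  have hS : ∀ p : Nat.Primes, Finite (Gamma ℤ_[p] ℚ_[p] L ⧸ S p) := fun p => by
    have : (S p).FiniteIndex := ⟨relIndex_conj_ne_zero ℤ_[p] ℚ_[p] L (g p)⟩
    exact Subgroup.finite_quotient_of_finiteIndex
  refine index_ne_zero_of_map _ (fun (a : GammaHat L) (p : {p : Nat.Primes | g p ∉ Gamma ℤ_[p] ℚ_[p] L}) =>
    (QuotientGroup.mk (⟨a.1 p.1, a.2 p.1⟩ : Gamma ℤ_[p.1] ℚ_[p.1] L) :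
      Gamma ℤ_[p.1] ℚ_[p.1] L ⧸ S p.1)) fun a b hab => ?_
  rw [Subgroup.mem_subgroupOf, mem_conj_iff]
  intro p
  by_cases hp : g p ∈ Gamma ℤ_[p] ℚ_[p] L
  · exact mul_mem (mul_mem (inv_mem hp) (mul_mem (inv_mem (a.2 p)) (b.2 p))) hp
  · have h1 := QuotientGroup.eq.1 (congrFun hab ⟨p, hp⟩)
    rwa [Subgroup.mem_subgroupOf, mem_conj_iff] at h1

/-- `(Γ̂, Δ̂)` is a Hecke pair. -/
instance isHeckeTriple_hat [Module.Finite ℤ L] :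
    IsHeckeTriple (DeltaHat L) (GammaHat L) (GammaHat L) :=
  IsHeckeTriple.of_diagonal (fun g hg => ⟨fun p => (hg p).1, by simp [hg _]⟩) fun g hg =>
    commensurable_of_relIndex _ g fun x hx => relIndex_conj_hat_ne_zero L x (by
      rcases hx with rfl | rfl
      · exact hg.2
      · simpa using hg.2)

/-- The global Hecke ring `R_L`, with respect to
`(Aut_ℤ(L), End_ℤ(L) ∩ Aut_ℚ(L ⊗ ℚ))`. -/
abbrev GlobalHeckeRing : Type _ := HeckeRing (Delta ℤ ℚ L) (Gamma ℤ ℚ L) ℤ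

/-- The local Hecke ring `R_{L_p}`, with respect to
`(Aut_{ℤ_p}(L ⊗ ℤ_p), End_{ℤ_p}(L ⊗ ℤ_p) ∩ Aut_{ℚ_p}(L ⊗ ℚ_p))`. -/
abbrev LocalHeckeRing (p : Nat.Primes) : Type _ :=
  HeckeRing (Delta ℤ_[p] ℚ_[p] L) (Gamma ℤ_[p] ℚ_[p] L) ℤ

/-- The Hecke ring `R̂_L` of the profinite completion, with respect to `(Γ̂, Δ̂)`. -/
abbrev ProfiniteHeckeRing : Type _ := HeckeRing (DeltaHat L) (GammaHat L) ℤ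

/-- The natural inclusion of `Δ_{L_p}` into `Δ̂`, with component `1` at the primes `≠ p`. -/
def localIncl (p : Nat.Primes) (g : Delta ℤ_[p] ℚ_[p] L) : DeltaHat L :=
  ⟨Pi.mulSingle p g.1, fun q => by
      rcases eq_or_ne q p with rfl | h
      · simp
      · simp [h, one_mem],
    (Set.finite_singleton p).subset fun q hq => by
      by_contra h
      exact hq (by simp [Pi.mulSingle_eq_of_ne (show q ≠ p from h), one_mem])⟩

/-- The map of double cosets `Γ_p α Γ_p ↦ Γ̂ α Γ̂`. -/
def localCoset (p : Nat.Primes) :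
    HeckeCoset (Delta ℤ_[p] ℚ_[p] L) (Gamma ℤ_[p] ℚ_[p] L) (Gamma ℤ_[p] ℚ_[p] L) →
      HeckeCoset (DeltaHat L) (GammaHat L) (GammaHat L) :=
  Quotient.lift (fun g => HeckeCoset.mk _ _ (localIncl L p g)) (by
    intro g h e
    obtain ⟨a, ha, b, hb, e⟩ := DoubleCoset.rel_iff.1 e
    have hmem : ∀ c ∈ Gamma ℤ_[p] ℚ_[p] L, (Pi.mulSingle p c : ProdGroup L) ∈ GammaHat L := by
      intro c hc
      show ∀ q : Nat.Primes, _
      intro q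
      rcases eq_or_ne q p with rfl | h
      · simpa using hc
      · simp [h, one_mem]
    refine HeckePair.mk_eq_mk.2 ⟨_, hmem a ha, _, hmem b hb, ?_⟩
    show (Pi.mulSingle p h.1 : ProdGroup L) =
      Pi.mulSingle p a * Pi.mulSingle p g.1 * Pi.mulSingle p b
    rw [e, Pi.mulSingle_mul, Pi.mulSingle_mul])

/-- The additive map `R_{L_p} → R̂_L` derived from the inclusion `Δ_{L_p} ⊆ Δ̂`. -/
def localMap (p : Nat.Primes) : LocalHeckeRing L p →+ ProfiniteHeckeRing L :=
  (Finsupp.mapDomain.addMonoidHom (localCoset L p) : (_ →₀ ℤ) →+ (_ →₀ ℤ))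

/-- The diagonal embedding `g ↦ (g)_p`, by extension of scalars from `ℚ` to `ℚ_p`. -/
def eta : LieAut ℚ (ℚ ⊗[ℤ] L) →* ProdGroup L :=
  MonoidHom.pi fun p => extendScalars ℚ_[p]

/-- The set `Γ_L \ η⁻¹(D) / Γ_L` of double cosets, for a double coset `D = Γ̂ α Γ̂`. -/
def etaFiber (D : HeckeCoset (DeltaHat L) (GammaHat L) (GammaHat L)) :
    Set (HeckeCoset (Delta ℤ ℚ L) (Gamma ℤ ℚ L) (Gamma ℤ ℚ L)) :=
  HeckeCoset.mk (Gamma ℤ ℚ L) (Gamma ℤ ℚ L) ''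
    {β | ∃ α : DeltaHat L, (α : ProdGroup L) = eta L β ∧ HeckeCoset.mk _ _ α = D}

/-- The additive map `η_L^* : R̂_L → R_L` sending a double coset `D = Γ̂ α Γ̂` to the sum of the
double cosets in `Γ_L \ η⁻¹(D) / Γ_L`. (This set is finite, as `Γ_L \ η⁻¹(D)` injects into
`Γ̂ \ D`.) -/
def etaStar : ProfiniteHeckeRing L →+ GlobalHeckeRing L :=
  (Finsupp.liftAddHom fun D => zmultiplesHom (GlobalHeckeRing L)
    (∑ᶠ E ∈ etaFiber L D, HeckeCosetModule.of (Finsupp.single E 1)) :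
      (HeckeCoset (DeltaHat L) (GammaHat L) (GammaHat L) →₀ ℤ) →+ GlobalHeckeRing L)

end Profinite

end LieAut

/-- The ideal `[L₂, [L₂, L₂]]` of the free Lie algebra `L₂` on two generators. -/
def heisenbergIdeal : LieIdeal ℤ (FreeLieAlgebra ℤ (Fin 2)) :=
  ⁅(⊤ : LieIdeal ℤ (FreeLieAlgebra ℤ (Fin 2))),
    ⁅(⊤ : LieIdeal ℤ (FreeLieAlgebra ℤ (Fin 2))), (⊤ : LieIdeal ℤ (FreeLieAlgebra ℤ (Fin 2)))⁆⁆

/-- The Heisenberg Lie algebra `L₂ / [L₂, [L₂, L₂]]` over `ℤ`. -/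
def Heisenberg : Type := FreeLieAlgebra ℤ (Fin 2) ⧸ heisenbergIdeal

namespace Heisenberg

instance : LieRing Heisenberg :=
  inferInstanceAs (LieRing (FreeLieAlgebra ℤ (Fin 2) ⧸ heisenbergIdeal))

/-- The projection from the free Lie algebra. -/
def proj : FreeLieAlgebra ℤ (Fin 2) →ₗ⁅ℤ⁆ Heisenberg :=
  { (LieSubmodule.Quotient.mk' heisenbergIdeal).toLinearMap.toAddMonoidHom.toIntLinearMap with
    map_lie' := by intro x y; rfl }

lemma proj_surjective : Function.Surjective proj := by
  rintro ⟨x⟩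
  exact ⟨x, rfl⟩

lemma lie_lie_eq_zero (a b c : Heisenberg) : ⁅a, ⁅b, c⁆⁆ = 0 := by
  obtain ⟨a, rfl⟩ := proj_surjective a
  obtain ⟨b, rfl⟩ := proj_surjective b
  obtain ⟨c, rfl⟩ := proj_surjective c
  rw [← LieHom.map_lie, ← LieHom.map_lie]
  refine (LieSubmodule.Quotient.mk_eq_zero' (N := heisenbergIdeal)).2 ?_
  exact LieSubmodule.lie_mem_lie (LieSubmodule.mem_top _)
    (LieSubmodule.lie_mem_lie (LieSubmodule.mem_top _) (LieSubmodule.mem_top _))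

/-- The two generators. -/
def gen (i : Fin 2) : Heisenberg := proj (FreeLieAlgebra.of ℤ i)

/-- The subalgebra spanned by the generators and their bracket. -/
def spanSubalgebra : LieSubalgebra ℤ Heisenberg :=
  { Submodule.span ℤ {gen 0, gen 1, ⁅gen 0, gen 1⁆} with
    lie_mem' := by
      intro u v hu hv
      have hu' : u ∈ Submodule.span ℤ {gen 0, gen 1, ⁅gen 0, gen 1⁆} := hu
      have hv' : v ∈ Submodule.span ℤ {gen 0, gen 1, ⁅gen 0, gen 1⁆} := hv
      rw [Submodule.mem_span_triple] at hu' hv'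
      obtain ⟨a, b, c, rfl⟩ := hu'
      obtain ⟨a', b', c', rfl⟩ := hv'
      refine Submodule.mem_span_triple.2 ⟨0, 0, a * b' - b * a', ?_⟩
      have h : ∀ x y z : Heisenberg, ⁅⁅y, z⁆, x⁆ = 0 := fun x y z => by
        rw [← lie_skew, lie_lie_eq_zero, neg_zero]
      simp only [add_lie, lie_add, smul_lie, lie_smul, lie_lie_eq_zero, h, lie_self,
        ← lie_skew (gen 1) (gen 0), smul_zero]
      module }

instance : Module.Finite ℤ Heisenberg := by
  classical
  refine ⟨⟨{gen 0, gen 1, ⁅gen 0, gen 1⁆}, eq_top_iff.2 fun u _ => ?_⟩⟩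
  obtain ⟨x, rfl⟩ := proj_surjective u
  have hgen : ∀ i, gen i ∈ spanSubalgebra := by
    intro i
    show gen i ∈ Submodule.span ℤ {gen 0, gen 1, ⁅gen 0, gen 1⁆}
    fin_cases i
    · exact Submodule.subset_span (by simp)
    · exact Submodule.subset_span (by simp)
  let F : FreeLieAlgebra ℤ (Fin 2) →ₗ⁅ℤ⁆ spanSubalgebra :=
    FreeLieAlgebra.lift ℤ fun i => ⟨gen i, hgen i⟩
  have hF : spanSubalgebra.incl.comp F = proj := by
    refine FreeLieAlgebra.hom_ext fun i => ?_
    show (F (FreeLieAlgebra.of ℤ i) : Heisenberg) = gen i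
    exact congrArg Subtype.val (FreeLieAlgebra.lift_of_apply
      (fun i => (⟨gen i, hgen i⟩ : spanSubalgebra)) i)
  have hx : proj x ∈ spanSubalgebra := by
    rw [← hF]
    exact (F x).2
  have hx' : proj x ∈ Submodule.span ℤ {gen 0, gen 1, ⁅gen 0, gen 1⁆} := hx
  simpa using hx'

end Heisenberg

end

/-! The theorem rests on a local-global principle, isolated in `IsLocalGlobal`: membership in `Γ`
and `Δ` is tested prime by prime, and every coset of `Γ_p` in the group over `ℚ_p` is represented by
a global element that lies in `Γ_q` for all `q ≠ p`, that is, one unramified outside `p` (a class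
number one statement). Hecke ring elements are treated as bi-invariant functions under convolution.
In these terms `η^* ∘ ι_p` is `pull`: compose with the localization at `p` on the elements
unramified outside `p`, and extend by zero.

Cosets `Γ g` with `g` unramified outside `p` correspond bijectively to all cosets of `Γ_p`
(`bijOn_cosetMap`). Moreover, when a product of two elements of `Δ` is unramified outside `p`, so
are the factors (`unramified_of_mul`). Hence at arguments unramified outside `p` a global
convolution is the local one (`conv_eq_conv_local`), and `pull` is multiplicative. It is injective
because every local coset has a global representative. For `p ≠ q` only one coset contributes to the
convolution of two pulled functions, and its value is symmetric in the two places
(`conv_pull_pull`), so the images commute.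

For non-generation, fix `p`. By the same computation, the global elements whose restriction to the
elements unramified outside `p` comes from the local Hecke ring at `p` form a subring
(`localSubring`). It contains every local image, since the image from `q ≠ p` restricts to a
multiple of the identity. Such elements cannot separate two global double cosets that merge at `p`,
so one such pair suffices.

An automorphism of the Heisenberg algebra is a matrix `A` in `GL₂` together with a translation part,
and acts on the centre by `det A`. The local-global principle follows by making the matrix upper
triangular with `Γ_p` and approximating its entries by elements of `ℤ[1/p]`. The pair is `A =
diag(5, 125)` with translation parts `(1, 5)` and `(1, 10)`. The 5-adic unit 2 carries one to the
other, while integral automorphisms doing so would have determinant congruent to 2 modulo 5, which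
`±1` is not. -/

noncomputable section

/-! ### Hecke rings of an abstract group with localizations -/

namespace HeckePair

section Additive

variable {G : Type*} [Group G] {Δ : Submonoid G} {H : Subgroup G}

/-- `toFun` as an additive homomorphism. -/
def toFunHom : HeckeRing Δ H ℤ →+ (G → ℤ) where
  toFun := toFun
  map_zero' := toFun_zero
  map_add' := toFun_add

lemma toFun_neg (f : HeckeRing Δ H ℤ) : toFun (-f) = -toFun f :=
  map_neg (toFunHom (Δ := Δ) (H := H)) f

lemma toFun_zsmul (n : ℤ) (f : HeckeRing Δ H ℤ) : toFun (n • f) = n • toFun f :=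
  map_zsmul (toFunHom (Δ := Δ) (H := H)) n f

end Additive

variable {G ι : Type*} [Group G] {Gl : ι → Type*} [∀ p, Group (Gl p)]

/-- A group with localizations `η p : G →* Gl p` in which membership of `Δ` and `Γ` is a local
condition, and in which every element of `Gl p` is equivalent, modulo `Γl p` on the left, to a
global element that lies in `Γl q` at all other places `q`. -/
structure IsLocalGlobal (Δ : Submonoid G) (Γ : Subgroup G) (Δl : ∀ p, Submonoid (Gl p))
    (Γl : ∀ p, Subgroup (Gl p)) (η : ∀ p, G →* Gl p) : Prop where
  mem_gamma_iff : ∀ g, g ∈ Γ ↔ ∀ p, η p g ∈ Γl p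
  mem_delta_iff : ∀ g, g ∈ Δ ↔ ∀ p, η p g ∈ Δl p
  mem_local_iff : ∀ p g, g ∈ Γl p ↔ g ∈ Δl p ∧ g⁻¹ ∈ Δl p
  exists_global : ∀ p (g : Gl p), ∃ h : G, (∀ q ≠ p, η q h ∈ Γl q) ∧ η p h * g⁻¹ ∈ Γl p

/-- The elements of `G` that lie in `Γl q` at every place `q ≠ p`. -/
def unramifiedOutside (Γl : ∀ p, Subgroup (Gl p)) (η : ∀ p, G →* Gl p) (p : ι) : Subgroup G where
  carrier := {g | ∀ q ≠ p, η q g ∈ Γl q}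
  one_mem' := fun q _ => by simp [one_mem]
  mul_mem' := fun ha hb q hq => by
    rw [map_mul]
    exact mul_mem (ha q hq) (hb q hq)
  inv_mem' := fun ha q hq => by
    rw [map_inv]
    exact inv_mem (ha q hq)

open Classical in
/-- The function `g ↦ f (η p g)` on the elements unramified outside `p`, extended by zero. -/
def pull (Γl : ∀ p, Subgroup (Gl p)) (η : ∀ p, G →* Gl p) (p : ι) (f : Gl p → ℤ) (g : G) : ℤ :=
  if g ∈ unramifiedOutside Γl η p then f (η p g) else 0

namespace IsLocalGlobal

variable {Δ : Submonoid G} {Γ : Subgroup G} {Δl : ∀ p, Submonoid (Gl p)}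
  {Γl : ∀ p, Subgroup (Gl p)} {η : ∀ p, G →* Gl p}

lemma mem_of_mem_unramified (h : IsLocalGlobal Δ Γ Δl Γl η) {p : ι} {g : G}
    (hg : g ∈ unramifiedOutside Γl η p) (hp : η p g ∈ Γl p) : g ∈ Γ :=
  (h.mem_gamma_iff g).2 fun q => by
    rcases eq_or_ne q p with rfl | hq
    · exact hp
    · exact hg q hq

lemma mem_delta_of_mem_unramified (h : IsLocalGlobal Δ Γ Δl Γl η) {p : ι} {g : G}
    (hg : g ∈ unramifiedOutside Γl η p) (hp : η p g ∈ Δl p) : g ∈ Δ :=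
  (h.mem_delta_iff g).2 fun q => by
    rcases eq_or_ne q p with rfl | hq
    · exact hp
    · exact ((h.mem_local_iff q _).1 (hg q hq)).1

lemma unramified_of_mem (h : IsLocalGlobal Δ Γ Δl Γl η) (p : ι) {g : G} (hg : g ∈ Γ) :
    g ∈ unramifiedOutside Γl η p :=
  fun q _ => (h.mem_gamma_iff g).1 hg q

/-- A factor in `Δ` of an element unramified outside `p` is unramified outside `p`. -/
lemma unramified_of_mul (h : IsLocalGlobal Δ Γ Δl Γl η) {p : ι} {a b : G} (ha : a ∈ Δ) (hb : b ∈ Δ)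
    (hab : a * b ∈ unramifiedOutside Γl η p) : b ∈ unramifiedOutside Γl η p := by
  intro q hq
  refine (h.mem_local_iff q _).2 ⟨(h.mem_delta_iff b).1 hb q, ?_⟩
  have h1 := ((h.mem_local_iff q _).1 (hab q hq)).2
  have h2 := mul_mem h1 ((h.mem_delta_iff a).1 ha q)
  simpa using h2

/-- The map `Γ g ↦ Γl p (η p g)` on cosets. -/
def cosetMap (h : IsLocalGlobal Δ Γ Δl Γl η) (p : ι) : Cosets Γ → Cosets (Γl p) :=
  Quotient.map (η p) fun x y hxy => by
    have h1 := (h.mem_gamma_iff _).1 (QuotientGroup.rightRel_apply.1 hxy) p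
    exact QuotientGroup.rightRel_apply.2 (by simpa using h1)

lemma cosetMap_eq (h : IsLocalGlobal Δ Γ Δl Γl η) (p : ι) (c : Cosets Γ) :
    h.cosetMap p c = Quotient.mk (QuotientGroup.rightRel (Γl p)) (η p c.out) := by
  conv_lhs => rw [← Quotient.out_eq c]
  rfl

lemma cosetMap_out (h : IsLocalGlobal Δ Γ Δl Γl η) (p : ι) (c : Cosets Γ) :
    ∃ a ∈ Γl p, (h.cosetMap p c).out = a * η p c.out := by
  rw [cosetMap_eq]
  exact out_mk _ _

lemma out_unramified (h : IsLocalGlobal Δ Γ Δl Γl η) {p : ι} {g : G}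
    (hg : g ∈ unramifiedOutside Γl η p) :
    (Quotient.mk (QuotientGroup.rightRel Γ) g).out ∈ unramifiedOutside Γl η p := by
  obtain ⟨a, ha, e⟩ := out_mk Γ g
  rw [e]
  exact mul_mem (h.unramified_of_mem p ha) hg

/-- The quotient of two such representatives lies in `Γl q` for all `q ≠ p` automatically, and at
`p` by the equality of the images; hence it lies in `Γ`. -/
lemma injOn_cosetMap (h : IsLocalGlobal Δ Γ Δl Γl η) (p : ι) :
    Set.InjOn (h.cosetMap p) {c | c.out ∈ unramifiedOutside Γl η p} := by
  intro c hc d hd e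
  rw [cosetMap_eq, cosetMap_eq] at e
  have e' := QuotientGroup.rightRel_apply.1 (Quotient.exact e)
  rw [← Quotient.out_eq c, ← Quotient.out_eq d]
  refine Quotient.sound (QuotientGroup.rightRel_apply.2 ?_)
  exact h.mem_of_mem_unramified (mul_mem hd (inv_mem hc)) (by simpa using e')

/-- Surjectivity is `exists_global`. This bijection turns sums over global cosets into sums over
local ones. -/
lemma bijOn_cosetMap (h : IsLocalGlobal Δ Γ Δl Γl η) (p : ι) :
    Set.BijOn (h.cosetMap p) {c | c.out ∈ unramifiedOutside Γl η p} Set.univ := by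
  refine ⟨fun _ _ => Set.mem_univ _, h.injOn_cosetMap p, fun d _ => ?_⟩
  obtain ⟨g, hg, hgd⟩ := h.exists_global p d.out
  refine ⟨Quotient.mk _ g, h.out_unramified hg, ?_⟩
  conv_rhs => rw [← Quotient.out_eq d]
  refine Quotient.sound (QuotientGroup.rightRel_apply.2 ?_)
  simpa using inv_mem hgd

/-- A convolution of functions supported on `Δ` can be computed at the place `p` for arguments
unramified outside `p`, if the functions come from the place `p` there. -/
lemma conv_eq_conv_local (h : IsLocalGlobal Δ Γ Δl Γl η) {p : ι} {φ ψ : G → ℤ} {f g : Gl p → ℤ}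
    (hφ : ∀ x, φ x ≠ 0 → x ∈ Δ) (hψ : ∀ x, ψ x ≠ 0 → x ∈ Δ)
    (hf : IsHeckeFun (Δl p) (Γl p) f) (hg : IsHeckeFun (Δl p) (Γl p) g)
    (hφf : ∀ x ∈ unramifiedOutside Γl η p, φ x = f (η p x))
    (hψg : ∀ x ∈ unramifiedOutside Γl η p, ψ x = g (η p x))
    {ξ : G} (hξ : ξ ∈ unramifiedOutside Γl η p) :
    conv Γ φ ψ ξ = conv (Γl p) f g (η p ξ) := by
  unfold conv
  rw [← finsum_mem_univ, ← finsum_mem_univ (fun c : Cosets (Γl p) => _),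
    ← finsum_mem_eq_of_bijOn (f := fun c : Cosets Γ => φ (ξ * c.out⁻¹) * ψ c.out) _
      (h.bijOn_cosetMap p)]
  -- A nonzero term writes `ξ` as a product of two elements of `Δ`, so its coset is unramified
  -- outside `p`; all other cosets drop out of the global sum.
  · refine (finsum_mem_inter_support_eq _ _ _ (Set.ext fun c => ?_)).symm
    simp only [Set.mem_inter_iff, Set.mem_ofPred_eq, Function.mem_support, Set.mem_univ, true_and,
      and_iff_right_iff_imp]
    intro hc
    exact h.unramified_of_mul (hφ _ (left_ne_zero_of_mul hc)) (hψ _ (right_ne_zero_of_mul hc))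
      (by simpa using hξ)
  · intro c hc
    obtain ⟨a, ha, e⟩ := h.cosetMap_out p c
    rw [e, hf.summand_eq hg ha, hφf _ (mul_mem hξ (inv_mem hc)), hψg _ hc, map_mul, map_inv]

lemma pull_of_mem {p : ι} (f : Gl p → ℤ) {g : G} (hg : g ∈ unramifiedOutside Γl η p) :
    pull Γl η p f g = f (η p g) := if_pos hg

lemma pull_of_notMem {p : ι} (f : Gl p → ℤ) {g : G} (hg : g ∉ unramifiedOutside Γl η p) :
    pull Γl η p f g = 0 := if_neg hg

/-- Finiteness of the support is inherited from `f`, because `cosetMap` is injective on the cosets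
unramified outside `p`. -/
lemma isHeckeFun_pull (h : IsLocalGlobal Δ Γ Δl Γl η) {p : ι} {f : Gl p → ℤ}
    (hf : IsHeckeFun (Δl p) (Γl p) f) : IsHeckeFun Δ Γ (pull Γl η p f) where
  left_inv a ha x := by
    have ha' := h.unramified_of_mem p ha
    by_cases hx : x ∈ unramifiedOutside Γl η p
    · rw [pull_of_mem f hx, pull_of_mem f (mul_mem ha' hx), map_mul,
        hf.left_inv _ ((h.mem_gamma_iff a).1 ha p)]
    · rw [pull_of_notMem f hx, pull_of_notMem f (by rwa [Subgroup.mul_mem_cancel_left _ ha'])]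
  right_inv a ha x := by
    have ha' := h.unramified_of_mem p ha
    by_cases hx : x ∈ unramifiedOutside Γl η p
    · rw [pull_of_mem f hx, pull_of_mem f (mul_mem hx ha'), map_mul,
        hf.right_inv _ ((h.mem_gamma_iff a).1 ha p)]
    · rw [pull_of_notMem f hx, pull_of_notMem f (by rwa [Subgroup.mul_mem_cancel_right _ ha'])]
  finite := by
    have hsub : {c : Cosets Γ | pull Γl η p f c.out ≠ 0} ⊆
        {c | c.out ∈ unramifiedOutside Γl η p} := fun c hc => by
      by_contra hc'
      exact hc (pull_of_notMem f hc')
    refine Set.Finite.of_finite_image (hf.finite.subset ?_) ((h.injOn_cosetMap p).mono hsub)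
    rintro _ ⟨c, hc, rfl⟩
    obtain ⟨a, ha, e⟩ := h.cosetMap_out p c
    show f _ ≠ 0
    rw [e, hf.left_inv a ha, ← pull_of_mem f (hsub hc)]
    exact hc
  supp x hx := by
    have hx' : x ∈ unramifiedOutside Γl η p := by
      by_contra hx'
      exact hx (pull_of_notMem f hx')
    rw [pull_of_mem f hx'] at hx
    exact h.mem_delta_of_mem_unramified hx' (hf.supp _ hx)

/-- At arguments unramified outside `p` this is `conv_eq_conv_local`. Elsewhere both sides vanish,
since the elements unramified outside `p` are closed under products. -/
lemma pull_conv (h : IsLocalGlobal Δ Γ Δl Γl η) {p : ι} {f g : Gl p → ℤ}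
    (hf : IsHeckeFun (Δl p) (Γl p) f) (hg : IsHeckeFun (Δl p) (Γl p) g) :
    pull Γl η p (conv (Γl p) f g) = conv Γ (pull Γl η p f) (pull Γl η p g) := by
  funext ξ
  by_cases hξ : ξ ∈ unramifiedOutside Γl η p
  · rw [pull_of_mem _ hξ]
    exact (h.conv_eq_conv_local (h.isHeckeFun_pull hf).supp (h.isHeckeFun_pull hg).supp hf hg
      (fun x hx => pull_of_mem f hx) (fun x hx => pull_of_mem g hx) hξ).symm
  · rw [pull_of_notMem _ hξ]
    by_contra hne
    obtain ⟨c, h1, h2⟩ := IsHeckeFun.exists_of_conv_ne_zero (Ne.symm hne)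
    have h1' : ξ * c.out⁻¹ ∈ unramifiedOutside Γl η p := by
      by_contra hx
      exact h1 (pull_of_notMem f hx)
    have h2' : c.out ∈ unramifiedOutside Γl η p := by
      by_contra hx
      exact h2 (pull_of_notMem g hx)
    exact hξ (by simpa using mul_mem h1' h2')

open Classical in
/-- The convolution of functions coming from two distinct places. -/
lemma conv_pull_pull (h : IsLocalGlobal Δ Γ Δl Γl η) {p q : ι} (hpq : p ≠ q) {f : Gl p → ℤ}
    {g : Gl q → ℤ} (hf : IsHeckeFun (Δl p) (Γl p) f) (hg : IsHeckeFun (Δl q) (Γl q) g) (ξ : G) :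
    conv Γ (pull Γl η p f) (pull Γl η q g) ξ =
      if ∀ r, r ≠ p → r ≠ q → η r ξ ∈ Γl r then f (η p ξ) * g (η q ξ) else 0 := by
  by_cases hξ : ∀ r, r ≠ p → r ≠ q → η r ξ ∈ Γl r
  · rw [if_pos hξ]
    -- The only contributing coset is that of `γ`, which carries the component of `ξ` at `q` and
    -- leaves the component at `p` to `ξ * γ⁻¹`.
    obtain ⟨γ, hγ, hγq⟩ := h.exists_global q (η q ξ)
    have hξγ : ξ * γ⁻¹ ∈ unramifiedOutside Γl η p := by
      intro r hr
      rw [map_mul, map_inv]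
      rcases eq_or_ne r q with rfl | hrq
      · simpa using inv_mem hγq
      · exact mul_mem (hξ r hr hrq) (inv_mem (hγ r hrq))
    unfold conv
    rw [finsum_eq_single _ (Quotient.mk (QuotientGroup.rightRel Γ) γ)]
    · obtain ⟨a, ha, e⟩ := out_mk Γ γ
      rw [e, (h.isHeckeFun_pull hf).summand_eq (h.isHeckeFun_pull hg) ha,
        pull_of_mem f hξγ, pull_of_mem g hγ, map_mul, map_inv,
        hf.right_inv _ (inv_mem (hγ p hpq)), ← hg.left_inv _ hγq (η q ξ)]
      simp
    · intro c hc
      by_contra hne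
      apply hc
      have h1 : ξ * c.out⁻¹ ∈ unramifiedOutside Γl η p := by
        by_contra hx
        exact left_ne_zero_of_mul hne (pull_of_notMem f hx)
      have h2 : c.out ∈ unramifiedOutside Γl η q := by
        by_contra hx
        exact right_ne_zero_of_mul hne (pull_of_notMem g hx)
      conv_lhs => rw [← Quotient.out_eq c]
      refine Quotient.sound (QuotientGroup.rightRel_apply.2 ?_)
      -- At `q`, both `γ` and `c.out` agree with `ξ` modulo `Γl q` on the left, hence with each
      -- other.
      refine h.mem_of_mem_unramified (p := q) (mul_mem hγ (inv_mem h2)) ?_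
      have h3 := mul_mem hγq (h1 q hpq.symm)
      simpa [mul_assoc] using h3
  · rw [if_neg hξ]
    by_contra hne
    obtain ⟨c, h1, h2⟩ := IsHeckeFun.exists_of_conv_ne_zero hne
    have h1' : ξ * c.out⁻¹ ∈ unramifiedOutside Γl η p := by
      by_contra hx
      exact h1 (pull_of_notMem f hx)
    have h2' : c.out ∈ unramifiedOutside Γl η q := by
      by_contra hx
      exact h2 (pull_of_notMem g hx)
    refine hξ fun r hr hr' => ?_
    simpa using mul_mem (h1' r hr) (h2' r hr')

variable [IsHeckeTriple Δ Γ Γ] [∀ p, IsHeckeTriple (Δl p) (Γl p) (Γl p)]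

/-- The homomorphism from the local Hecke ring at `p` to the global Hecke ring. -/
def localHom (h : IsLocalGlobal Δ Γ Δl Γl η) (p : ι) :
    HeckeRing (Δl p) (Γl p) ℤ →+* HeckeRing Δ Γ ℤ where
  toFun x := ofFun (pull Γl η p (toFun x)) (h.isHeckeFun_pull (isHeckeFun_toFun x))
  map_one' := toFun_injective (by
    classical
    rw [toFun_ofFun]
    funext g
    rw [toFun_one]
    by_cases hg : g ∈ unramifiedOutside Γl η p
    · rw [pull_of_mem _ hg, toFun_one]
      refine if_congr ⟨h.mem_of_mem_unramified hg, fun hg' => ?_⟩ rfl rfl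
      exact (h.mem_gamma_iff g).1 hg' p
    · rw [pull_of_notMem _ hg, if_neg fun hg' => hg (h.unramified_of_mem p hg')])
  map_mul' x y := toFun_injective (by
    rw [toFun_ofFun, toFun_mul, toFun_mul, toFun_ofFun, toFun_ofFun]
    exact h.pull_conv (isHeckeFun_toFun x) (isHeckeFun_toFun y))
  map_zero' := toFun_injective (by
    rw [toFun_ofFun, toFun_zero, toFun_zero]
    funext g
    simp [pull])
  map_add' x y := toFun_injective (by
    rw [toFun_ofFun, toFun_add, toFun_add, toFun_ofFun, toFun_ofFun]
    funext g
    by_cases hg : g ∈ unramifiedOutside Γl η p <;> simp [pull, hg])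

lemma toFun_localHom (h : IsLocalGlobal Δ Γ Δl Γl η) (p : ι) (x : HeckeRing (Δl p) (Γl p) ℤ) :
    toFun (h.localHom p x) = pull Γl η p (toFun x) :=
  toFun_ofFun _ (h.isHeckeFun_pull (isHeckeFun_toFun x))

/-- The value of a local function at `g` can be read off from its pull-back at a global
representative of the coset of `g`. -/
lemma localHom_injective (h : IsLocalGlobal Δ Γ Δl Γl η) (p : ι) :
    Function.Injective (h.localHom p) := by
  intro x y e
  refine toFun_injective (funext fun g => ?_)
  obtain ⟨γ, hγ, hγg⟩ := h.exists_global p g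
  have e' := congrFun (congrArg toFun e) γ
  rw [toFun_localHom, toFun_localHom, pull_of_mem _ hγ, pull_of_mem _ hγ] at e'
  rw [← (isHeckeFun_toFun x).left_inv _ hγg, ← (isHeckeFun_toFun y).left_inv _ hγg]
  simpa using e'

/-- The formula of `conv_pull_pull` is symmetric under exchanging the two places, as the values are
integers. -/
lemma commute_localHom (h : IsLocalGlobal Δ Γ Δl Γl η) {p q : ι} (hpq : p ≠ q)
    (x : HeckeRing (Δl p) (Γl p) ℤ) (y : HeckeRing (Δl q) (Γl q) ℤ) :
    Commute (h.localHom p x) (h.localHom q y) := by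
  classical
  refine toFun_injective (funext fun ξ => ?_)
  rw [toFun_mul, toFun_mul, toFun_localHom, toFun_localHom,
    h.conv_pull_pull hpq (isHeckeFun_toFun x) (isHeckeFun_toFun y),
    h.conv_pull_pull hpq.symm (isHeckeFun_toFun y) (isHeckeFun_toFun x), mul_comm]
  exact if_congr ⟨fun H r h1 h2 => H r h2 h1, fun H r h1 h2 => H r h2 h1⟩ rfl rfl

/-- The elements of the global Hecke ring whose restriction to the elements unramified outside `p`
comes from the local Hecke ring at `p`. -/
def localSubring (h : IsLocalGlobal Δ Γ Δl Γl η) (p : ι) : Subring (HeckeRing Δ Γ ℤ) where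
  carrier := {x | ∃ y : HeckeRing (Δl p) (Γl p) ℤ,
    ∀ g ∈ unramifiedOutside Γl η p, toFun x g = toFun y (η p g)}
  zero_mem' := ⟨0, fun g _ => by simp [toFun_zero]⟩
  one_mem' := ⟨1, fun g hg => by
    classical
    rw [toFun_one, toFun_one]
    exact if_congr ⟨fun hg' => (h.mem_gamma_iff g).1 hg' p, h.mem_of_mem_unramified hg⟩ rfl rfl⟩
  add_mem' := by
    rintro x x' ⟨y, hy⟩ ⟨y', hy'⟩
    exact ⟨y + y', fun g hg => by simp [toFun_add, hy g hg, hy' g hg]⟩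
  neg_mem' := by
    rintro x ⟨y, hy⟩
    exact ⟨-y, fun g hg => by simp [toFun_neg, hy g hg]⟩
  mul_mem' := by
    rintro x x' ⟨y, hy⟩ ⟨y', hy'⟩
    refine ⟨y * y', fun g hg => ?_⟩
    rw [toFun_mul, toFun_mul]
    exact h.conv_eq_conv_local (isHeckeFun_toFun x).supp (isHeckeFun_toFun x').supp
      (isHeckeFun_toFun y) (isHeckeFun_toFun y') hy hy' hg

/-- For `q ≠ p`, an element unramified both outside `p` and outside `q` lies in `Γ`. So the image
from `q` is supported on `Γ` among the elements unramified outside `p`, and restricts there to a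
multiple of the identity. -/
lemma localHom_mem_localSubring (h : IsLocalGlobal Δ Γ Δl Γl η) (p q : ι)
    (x : HeckeRing (Δl q) (Γl q) ℤ) : h.localHom q x ∈ h.localSubring p := by
  classical
  rcases eq_or_ne q p with rfl | hqp
  · exact ⟨x, fun g hg => by rw [toFun_localHom, pull_of_mem _ hg]⟩
  · refine ⟨toFun x 1 • 1, fun g hg => ?_⟩
    rw [toFun_localHom, toFun_zsmul, Pi.smul_apply, toFun_one]
    by_cases hgp : η p g ∈ Γl p
    · have hgΓ := h.mem_of_mem_unramified hg hgp
      rw [pull_of_mem _ (h.unramified_of_mem q hgΓ), if_pos hgp,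
        ← mul_one (η q g), (isHeckeFun_toFun x).left_inv _ (hg q hqp)]
      simp
    · rw [pull_of_notMem _ fun hg' => hgp (hg' p hqp.symm), if_neg hgp, smul_zero]

/-- The local Hecke rings do not generate the global one, if there are two elements of `Δ`
unramified outside `p` whose double cosets are distinct but become equal at `p`. -/
lemma iSup_range_localHom_ne_top (h : IsLocalGlobal Δ Γ Δl Γl η) {p : ι} {ξ ξ' : G} (hξΔ : ξ ∈ Δ)
    (hξ : ξ ∈ unramifiedOutside Γl η p) (hξ' : ξ' ∈ unramifiedOutside Γl η p)
    (hloc : η p ξ' ∈ DoubleCoset.doubleCoset (η p ξ) (Γl p) (Γl p))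
    (hglob : ξ' ∉ DoubleCoset.doubleCoset ξ Γ Γ) :
    (⨆ p, (h.localHom p).range) ≠ ⊤ := by
  classical
  intro htop
  have hle : (⨆ p, (h.localHom p).range) ≤ h.localSubring p :=
    iSup_le fun q => by
      rintro _ ⟨x, rfl⟩
      exact h.localHom_mem_localSubring p q x
  rw [htop] at hle
  -- The indicator function of the double coset of `ξ` separates `ξ` from `ξ'`, but a bi-invariant
  -- function `y` at `p` takes the same value on both.
  obtain ⟨y, hy⟩ := hle (Subring.mem_top (basis Γ (⟨ξ, hξΔ⟩ : Δ)))
  obtain ⟨a, ha, b, hb, e⟩ := DoubleCoset.mem_doubleCoset.1 hloc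
  have h1 := hy ξ hξ
  have h2 := hy ξ' hξ'
  rw [e, (isHeckeFun_toFun y).right_inv b hb, (isHeckeFun_toFun y).left_inv a ha, ← h1,
    toFun_basis, toFun_basis, if_neg hglob, if_pos (DoubleCoset.mem_doubleCoset_self Γ Γ ξ)] at h2
  exact zero_ne_one h2

end IsLocalGlobal

end HeckePair

/-! ### The abstract homomorphism is `η^* ∘ ι_p` -/

namespace HeckePair

variable {G : Type*} [Group G] {Δ : Submonoid G} {H : Subgroup G}

-- Finiteness of `S` matters: over an infinite set the `finsum` would take its default value zero.
open Classical in
lemma toFun_sum_single {S : Set (HeckeCoset Δ H H)} (hS : S.Finite) (x : Δ) :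
    toFun (∑ᶠ E ∈ S, (HeckeCosetModule.of (Finsupp.single E 1) : HeckeRing Δ H ℤ)) x =
      if HeckeCoset.mk H H x ∈ S then 1 else 0 := by
  have h1 : ∀ E : HeckeCoset Δ H H,
      toFun (HeckeCosetModule.of (Finsupp.single E 1) : HeckeRing Δ H ℤ) x =
        if HeckeCoset.mk H H x = E then 1 else 0 := fun E => by
    rw [toFun_coe, HeckeCosetModule.of_apply, Finsupp.single_apply]
    exact if_congr eq_comm rfl rfl
  rw [finsum_mem_eq_finite_toFinset_sum _ hS]
  show toFunHom (∑ E ∈ hS.toFinset, (HeckeCosetModule.of (Finsupp.single E 1) : HeckeRing Δ H ℤ))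
    (x : G) = _
  rw [map_sum, Finset.sum_apply]
  refine (Finset.sum_congr rfl fun E _ => h1 E).trans ?_
  rw [Finset.sum_ite_eq]
  simp

/-- Two additive maps out of a Hecke ring agree if they agree on double cosets. -/
lemma addHom_ext {A : Type*} [AddCommGroup A] {f g : HeckeRing Δ H ℤ →+ A}
    (h : ∀ α : Δ, f (basis H α) = g (basis H α)) : f = g := by
  refine Finsupp.addHom_ext' (M := ℤ) fun D => AddMonoidHom.ext_int ?_
  obtain ⟨α, rfl⟩ := Quotient.exists_rep D
  exact h α

end HeckePair

namespace LieAut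

open HeckePair

variable (L : Type*) [LieRing L]

/-- The local-global principle for the automorphisms of a Lie ring. -/
def HasLocalGlobal : Prop :=
  IsLocalGlobal (Gl := fun p : Nat.Primes => LieAut ℚ_[p] (ℚ_[p] ⊗[ℤ] L))
    (Delta ℤ ℚ L) (Gamma ℤ ℚ L) (fun p => Delta ℤ_[p] ℚ_[p] L) (fun p => Gamma ℤ_[p] ℚ_[p] L)
    (fun p => extendScalars ℚ_[p])

variable {L}

/-- The criterion does not depend on the representative `β`, because `η` maps `Γ` into `Γ̂`. -/
lemma mem_etaFiber_iff {D : HeckeCoset (DeltaHat L) (GammaHat L) (GammaHat L)} {α : DeltaHat L}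
    (hα : HeckeCoset.mk _ _ α = D) [IsHeckeTriple (DeltaHat L) (GammaHat L) (GammaHat L)]
    (h : HasLocalGlobal L) (β : Delta ℤ ℚ L) :
    HeckeCoset.mk (Gamma ℤ ℚ L) (Gamma ℤ ℚ L) β ∈ etaFiber L D ↔
      ∃ a ∈ GammaHat L, ∃ b ∈ GammaHat L, eta L β = a * α * b := by
  have hη : ∀ c ∈ Gamma ℤ ℚ L, eta L c ∈ GammaHat L := fun c hc p => (h.mem_gamma_iff c).1 hc p
  constructor
  · rintro ⟨β', ⟨α', h1, h2⟩, h3⟩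
    obtain ⟨a, ha, b, hb, e⟩ := mk_eq_mk.1 (hα.trans h2.symm)
    obtain ⟨c, hc, d, hd, e'⟩ := mk_eq_mk.1 h3
    refine ⟨eta L c * a, mul_mem (hη c hc) ha, b * eta L d, mul_mem hb (hη d hd), ?_⟩
    rw [e', map_mul, map_mul, ← h1, e]
    group
  · rintro ⟨a, ha, b, hb, e⟩
    have hmem : eta L β ∈ DeltaHat L := by
      rw [e]
      exact mul_mem (mul_mem (IsHeckeTriple.mem_of_mem_left (GammaHat L) ha) α.2)
        (IsHeckeTriple.mem_of_mem_left (GammaHat L) hb)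
    refine ⟨β, ⟨⟨eta L β, hmem⟩, rfl, ?_⟩, rfl⟩
    rw [← hα]
    exact (mk_eq_mk.2 ⟨a, ha, b, hb, e⟩).symm

/-- The double coset `D` consists of finitely many cosets `Γ̂ g`. Representatives of distinct global
double cosets land in distinct ones, since an element of the global group lies in `Γ` as soon as its
diagonal image lies in `Γ̂`. -/
lemma finite_etaFiber [IsHeckeTriple (DeltaHat L) (GammaHat L) (GammaHat L)]
    (h : HasLocalGlobal L) (D : HeckeCoset (DeltaHat L) (GammaHat L) (GammaHat L)) :
    (etaFiber L D).Finite := by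
  obtain ⟨α, hα⟩ := Quotient.exists_rep D
  refine Set.Finite.of_finite_image (f := fun E => Quotient.mk (QuotientGroup.rightRel (GammaHat L))
    (eta L ((Quotient.out E : Delta ℤ ℚ L) : LieAut ℚ (ℚ ⊗[ℤ] L)))) ?_ ?_
  · refine (finite_cosets (IsHeckeTriple.mem_commensurator_right (GammaHat L) α)).subset ?_
    rintro _ ⟨E, hE, rfl⟩
    have hE' : HeckeCoset.mk (Gamma ℤ ℚ L) (Gamma ℤ ℚ L) (Quotient.out E) ∈ etaFiber L D := by
      have : HeckeCoset.mk (Gamma ℤ ℚ L) (Gamma ℤ ℚ L) (Quotient.out E) = E := Quotient.out_eq E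
      rwa [this]
    obtain ⟨a, ha, b, hb, e⟩ := (mem_etaFiber_iff hα h _).1 hE'
    obtain ⟨c, hc, e'⟩ := out_mk (GammaHat L)
      (eta L ((Quotient.out E : Delta ℤ ℚ L) : LieAut ℚ (ℚ ⊗[ℤ] L)))
    refine ⟨c * a, mul_mem hc ha, b, hb, ?_⟩
    rw [e', e]
    group
  · intro D _ E _ e
    rw [← Quotient.out_eq D, ← Quotient.out_eq E]
    have e' := QuotientGroup.rightRel_apply.1 (Quotient.exact e)
    refine mk_eq_mk.2 ⟨((Quotient.out E : Delta ℤ ℚ L) : LieAut ℚ (ℚ ⊗[ℤ] L)) *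
      ((Quotient.out D : Delta ℤ ℚ L) : LieAut ℚ (ℚ ⊗[ℤ] L))⁻¹, ?_, 1, one_mem _, by simp⟩
    refine (h.mem_gamma_iff _).2 fun p => ?_
    have := e' p
    rwa [← map_inv, ← map_mul] at this

lemma localIncl_doubleCoset_iff (p : Nat.Primes) (α : Delta ℤ_[p] ℚ_[p] L)
    (β : LieAut ℚ (ℚ ⊗[ℤ] L)) :
    (∃ a ∈ GammaHat L, ∃ b ∈ GammaHat L, eta L β = a * (localIncl L p α : ProdGroup L) * b) ↔
      (∀ q : Nat.Primes, q ≠ p → extendScalars ℚ_[q] β ∈ Gamma ℤ_[q] ℚ_[q] L) ∧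
      extendScalars ℚ_[p] β ∈ DoubleCoset.doubleCoset (α : LieAut ℚ_[p] (ℚ_[p] ⊗[ℤ] L))
        (Gamma ℤ_[p] ℚ_[p] L) (Gamma ℤ_[p] ℚ_[p] L) := by
  have hmem : ∀ c ∈ Gamma ℤ_[p] ℚ_[p] L, (Pi.mulSingle p c : ProdGroup L) ∈ GammaHat L := by
    intro c hc q
    rcases eq_or_ne q p with rfl | h
    · simpa using hc
    · simp [h, one_mem]
  constructor
  · rintro ⟨a, ha, b, hb, e⟩
    refine ⟨fun q hq => ?_, DoubleCoset.mem_doubleCoset.2 ⟨a p, ha p, b p, hb p, ?_⟩⟩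
    · have e' : extendScalars ℚ_[q] β = a q * (Pi.mulSingle p α.1 : ProdGroup L) q * b q :=
        congrFun e q
      rw [e', Pi.mulSingle_eq_of_ne hq, mul_one]
      exact mul_mem (ha q) (hb q)
    · have e' : extendScalars ℚ_[p] β = a p * (Pi.mulSingle p α.1 : ProdGroup L) p * b p :=
        congrFun e p
      rw [e', Pi.mulSingle_eq_same]
  · rintro ⟨h1, h2⟩
    obtain ⟨a, ha, b, hb, e⟩ := DoubleCoset.mem_doubleCoset.1 h2
    -- The left factor absorbs all components of `eta L β` away from `p`; at `p` it is just `a`.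
    refine ⟨eta L β * (Pi.mulSingle p (extendScalars ℚ_[p] β))⁻¹ * Pi.mulSingle p a, ?_,
      Pi.mulSingle p b, hmem b hb, ?_⟩
    · refine mul_mem (fun q => ?_) (hmem a ha)
      rcases eq_or_ne q p with rfl | hq
      · have : (eta L β * (Pi.mulSingle q (extendScalars ℚ_[q] β))⁻¹ : ProdGroup L) q = 1 := by
          rw [Pi.mul_apply, Pi.inv_apply, Pi.mulSingle_eq_same]
          exact mul_inv_cancel _
        rw [this]
        exact one_mem _
      · rw [Pi.mul_apply, Pi.inv_apply, Pi.mulSingle_eq_of_ne hq, inv_one, mul_one]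
        exact h1 q hq
    · show _ = _ * (Pi.mulSingle p α.1 : ProdGroup L) * _
      rw [e, Pi.mulSingle_mul, Pi.mulSingle_mul]
      group

lemma localMap_basis (p : Nat.Primes) (α : Delta ℤ_[p] ℚ_[p] L) :
    localMap L p (basis (Gamma ℤ_[p] ℚ_[p] L) α) = basis (GammaHat L) (localIncl L p α) :=
  Finsupp.mapDomain_single

lemma etaStar_basis (α : DeltaHat L) :
    etaStar L (basis (GammaHat L) α) =
      ∑ᶠ E ∈ etaFiber L (HeckeCoset.mk _ _ α),
        (HeckeCosetModule.of (Finsupp.single E 1) : GlobalHeckeRing L) := by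
  unfold etaStar basis
  refine (Finsupp.liftAddHom_apply_single (M := ℤ) (N := GlobalHeckeRing L) _ _ _).trans ?_
  rw [zmultiplesHom_apply, one_zsmul]

variable [Module.Finite ℤ L]

/-- The homomorphism of the local-global principle is the composition `η^* ∘ ι_p`. -/
lemma localHom_eq_etaStar (h : HasLocalGlobal L) (p : Nat.Primes) (x : LocalHeckeRing L p) :
    IsLocalGlobal.localHom h p x = etaStar L (localMap L p x) := by
  classical
  suffices (IsLocalGlobal.localHom h p : LocalHeckeRing L p →+ GlobalHeckeRing L) =
      (etaStar L).comp (localMap L p) from DFunLike.congr_fun this x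
  refine addHom_ext fun α => toFun_injective (funext fun ξ => ?_)
  rw [AddMonoidHom.comp_apply, localMap_basis, etaStar_basis]
  refine (congrFun (IsLocalGlobal.toFun_localHom h p (basis _ α)) ξ).trans ?_
  by_cases hξ : ξ ∈ Delta ℤ ℚ L
  · have h1 := (mem_etaFiber_iff (D := HeckeCoset.mk _ _ (localIncl L p α)) rfl h ⟨ξ, hξ⟩).trans
      (localIncl_doubleCoset_iff p α ξ)
    have h2 := toFun_sum_single (finite_etaFiber h (HeckeCoset.mk _ _ (localIncl L p α))) ⟨ξ, hξ⟩
    rw [h2, if_congr h1 rfl rfl, ite_and]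
    unfold pull
    rw [toFun_basis]
    rfl
  · rw [toFun, dif_neg hξ]
    by_contra hne
    exact hξ ((IsLocalGlobal.isHeckeFun_pull h (isHeckeFun_toFun _)).supp ξ hne)

end LieAut

/-! ### A basis of the Heisenberg Lie algebra -/

/-- The free `ℤ`-module of rank three with the bracket of the Heisenberg Lie algebra. -/
@[ext] structure HeisenbergModel where
  x : ℤ
  y : ℤ
  z : ℤ

namespace HeisenbergModel

instance : Zero HeisenbergModel := ⟨⟨0, 0, 0⟩⟩
instance : Add HeisenbergModel := ⟨fun a b => ⟨a.x + b.x, a.y + b.y, a.z + b.z⟩⟩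
instance : Neg HeisenbergModel := ⟨fun a => ⟨-a.x, -a.y, -a.z⟩⟩
instance : Bracket HeisenbergModel HeisenbergModel := ⟨fun a b => ⟨0, 0, a.x * b.y - a.y * b.x⟩⟩

@[simp] lemma zero_x : (0 : HeisenbergModel).x = 0 := rfl
@[simp] lemma zero_y : (0 : HeisenbergModel).y = 0 := rfl
@[simp] lemma zero_z : (0 : HeisenbergModel).z = 0 := rfl
@[simp] lemma add_x (a b : HeisenbergModel) : (a + b).x = a.x + b.x := rfl
@[simp] lemma add_y (a b : HeisenbergModel) : (a + b).y = a.y + b.y := rfl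
@[simp] lemma add_z (a b : HeisenbergModel) : (a + b).z = a.z + b.z := rfl
@[simp] lemma neg_x (a : HeisenbergModel) : (-a).x = -a.x := rfl
@[simp] lemma neg_y (a : HeisenbergModel) : (-a).y = -a.y := rfl
@[simp] lemma neg_z (a : HeisenbergModel) : (-a).z = -a.z := rfl
@[simp] lemma lie_x (a b : HeisenbergModel) : ⁅a, b⁆.x = 0 := rfl
@[simp] lemma lie_y (a b : HeisenbergModel) : ⁅a, b⁆.y = 0 := rfl
@[simp] lemma lie_z (a b : HeisenbergModel) : ⁅a, b⁆.z = a.x * b.y - a.y * b.x := rfl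

instance : AddCommGroup HeisenbergModel where
  add_assoc a b c := by ext <;> simp [add_assoc]
  zero_add a := by ext <;> simp
  add_zero a := by ext <;> simp
  add_comm a b := by ext <;> simp [add_comm]
  neg_add_cancel a := by ext <;> simp
  nsmul := nsmulRec
  zsmul := zsmulRec

instance : LieRing HeisenbergModel where
  add_lie a b c := by ext <;> simp; ring
  lie_add a b c := by ext <;> simp; ring
  lie_self a := by ext <;> simp; ring
  leibniz_lie a b c := by ext <;> simp

/-- The coordinates as an additive map. -/
def coords : HeisenbergModel →+ (Fin 3 → ℤ) where
  toFun a := ![a.x, a.y, a.z]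
  map_zero' := by ext i; fin_cases i <;> rfl
  map_add' a b := by ext i; fin_cases i <;> rfl

/-- The map from the free Lie algebra sending the generators to the first two basis vectors. -/
def ofFree : FreeLieAlgebra ℤ (Fin 2) →ₗ⁅ℤ⁆ HeisenbergModel :=
  FreeLieAlgebra.lift ℤ ![⟨1, 0, 0⟩, ⟨0, 1, 0⟩]

lemma ofFree_zero : ofFree (FreeLieAlgebra.of ℤ 0) = ⟨1, 0, 0⟩ :=
  FreeLieAlgebra.lift_of_apply _ _

lemma ofFree_one : ofFree (FreeLieAlgebra.of ℤ 1) = ⟨0, 1, 0⟩ :=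
  FreeLieAlgebra.lift_of_apply _ _

/-- Brackets in the model have no `x` and `y` coordinates, and a bracket sees only these
coordinates, so triple brackets vanish. The model therefore receives a map from the quotient and
detects that its three spanning vectors are independent. -/
lemma ofFree_eq_zero {u : FreeLieAlgebra ℤ (Fin 2)} (hu : u ∈ heisenbergIdeal) : ofFree u = 0 := by
  have h : heisenbergIdeal ≤ ofFree.ker := by
    refine (LieSubmodule.lie_le_iff _ _ _).2 fun a _ b hb => ?_
    have h2 : ∀ v ∈ ⁅(⊤ : LieIdeal ℤ (FreeLieAlgebra ℤ (Fin 2))),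
        (⊤ : LieIdeal ℤ (FreeLieAlgebra ℤ (Fin 2)))⁆, (ofFree v).x = 0 ∧ (ofFree v).y = 0 := by
      intro v hv
      rw [← LieSubmodule.mem_toSubmodule, LieSubmodule.lieIdeal_oper_eq_linear_span'] at hv
      induction hv using Submodule.span_induction with
      | mem w hw =>
        obtain ⟨c, _, d, _, rfl⟩ := hw
        simp [LieHom.map_lie]
      | zero => simp
      | add v w _ _ hv hw => simp [hv, hw]
      | smul n v _ hv =>
        -- The integer action on the model is defined by recursion, so it is read in coordinates
        -- through the additive map `coords`.
        have e : coords (ofFree (n • v)) = n • coords (ofFree v) := by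
          rw [map_smul, map_zsmul]
        have e0 := congrFun e 0
        have e1 := congrFun e 1
        simp only [coords, AddMonoidHom.coe_mk, ZeroHom.coe_mk, Pi.smul_apply] at e0 e1
        simpa [hv] using And.intro e0 e1
    obtain ⟨h3, h4⟩ := h2 b hb
    rw [LieHom.mem_ker, LieHom.map_lie]
    ext <;> simp [h3, h4]
  exact LieHom.mem_ker.1 (h hu)

end HeisenbergModel

namespace Heisenberg

/-- The generators and their bracket. -/
def basisVec : Fin 3 → Heisenberg := ![gen 0, gen 1, ⁅gen 0, gen 1⁆]

lemma linearIndependent_basisVec : LinearIndependent ℤ basisVec := by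
  rw [Fintype.linearIndependent_iff]
  intro c hc
  rw [Fin.sum_univ_three] at hc
  have hc' : proj (c 0 • FreeLieAlgebra.of ℤ 0 + c 1 • FreeLieAlgebra.of ℤ 1 +
      c 2 • ⁅FreeLieAlgebra.of ℤ (0 : Fin 2), FreeLieAlgebra.of ℤ (1 : Fin 2)⁆) = 0 := by
    rw [map_add, map_add, map_smul, map_smul, map_smul, LieHom.map_lie]
    exact hc
  have h0 := HeisenbergModel.ofFree_eq_zero
    ((LieSubmodule.Quotient.mk_eq_zero' (N := heisenbergIdeal)).1 hc')
  have h1 := congrArg HeisenbergModel.coords h0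
  simp only [map_add, map_zsmul, map_zero, LieHom.map_lie, HeisenbergModel.ofFree_zero,
    HeisenbergModel.ofFree_one] at h1
  intro i
  have h2 := congrFun h1 i
  fin_cases i <;> simpa [HeisenbergModel.coords] using h2

/-- The span is closed under brackets, since all triple brackets vanish, and it contains the
generators; so the projection from the free Lie algebra factors through it. -/
lemma span_basisVec : ⊤ ≤ Submodule.span ℤ (Set.range basisVec) := by
  intro u _
  obtain ⟨x, rfl⟩ := proj_surjective u
  have hgen : ∀ i, gen i ∈ spanSubalgebra := by
    intro i
    show gen i ∈ Submodule.span ℤ {gen 0, gen 1, ⁅gen 0, gen 1⁆}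
    fin_cases i
    · exact Submodule.subset_span (by simp)
    · exact Submodule.subset_span (by simp)
  let F : FreeLieAlgebra ℤ (Fin 2) →ₗ⁅ℤ⁆ spanSubalgebra :=
    FreeLieAlgebra.lift ℤ fun i => ⟨gen i, hgen i⟩
  have hF : spanSubalgebra.incl.comp F = proj := by
    refine FreeLieAlgebra.hom_ext fun i => ?_
    show (F (FreeLieAlgebra.of ℤ i) : Heisenberg) = gen i
    exact congrArg Subtype.val (FreeLieAlgebra.lift_of_apply
      (fun i => (⟨gen i, hgen i⟩ : spanSubalgebra)) i)
  have hx : proj x ∈ spanSubalgebra := by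
    rw [← hF]
    exact (F x).2
  have hx' : proj x ∈ Submodule.span ℤ {gen 0, gen 1, ⁅gen 0, gen 1⁆} := hx
  have hr : Set.range basisVec = {gen 0, gen 1, ⁅gen 0, gen 1⁆} := by
    simp [basisVec, Matrix.range_cons]
    ext v
    simp
    tauto
  rwa [hr]

/-- The `ℤ`-basis of the Heisenberg Lie algebra. -/
def zbasis : Module.Basis (Fin 3) ℤ Heisenberg :=
  Module.Basis.mk linearIndependent_basisVec span_basisVec

lemma zbasis_apply (i : Fin 3) : zbasis i = basisVec i := Module.Basis.mk_apply _ _ _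

section Field

variable (K : Type*) [Field K]

/-- The basis of the Heisenberg Lie algebra over `K`. -/
def kbasis : Module.Basis (Fin 3) K (K ⊗[ℤ] Heisenberg) := Algebra.TensorProduct.basis K zbasis

lemma kbasis_apply (i : Fin 3) : kbasis K i = 1 ⊗ₜ[ℤ] basisVec i := by
  rw [kbasis, Algebra.TensorProduct.basis_apply, zbasis_apply]

variable {K}

lemma kbasis_repr_tmul (a : K) (x : Heisenberg) (j : Fin 3) :
    (kbasis K).repr (a ⊗ₜ[ℤ] x) j = a * (zbasis.repr x j : K) := by
  rw [kbasis, Algebra.TensorProduct.basis_repr_tmul]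
  simp

lemma lie_kbasis (i j : Fin 3) : ⁅kbasis K i, kbasis K j⁆ =
    ((if i = 0 ∧ j = 1 then 1 else 0) - (if i = 1 ∧ j = 0 then 1 else 0) : K) • kbasis K 2 := by
  have h : ∀ x y z : Heisenberg, ⁅⁅y, z⁆, x⁆ = 0 := fun x y z => by
    rw [← lie_skew, lie_lie_eq_zero, neg_zero]
  rw [kbasis_apply, kbasis_apply, kbasis_apply, LieAlgebra.ExtendScalars.bracket_tmul, mul_one]
  fin_cases i <;> fin_cases j <;> simp [basisVec, lie_lie_eq_zero, h]
  rw [← lie_skew, TensorProduct.tmul_neg]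

lemma lie_eq (v w : K ⊗[ℤ] Heisenberg) : ⁅v, w⁆ =
    ((kbasis K).repr v 0 * (kbasis K).repr w 1 - (kbasis K).repr v 1 * (kbasis K).repr w 0) •
      kbasis K 2 := by
  conv_lhs => rw [← (kbasis K).sum_repr v, ← (kbasis K).sum_repr w]
  simp only [Fin.sum_univ_three, add_lie, lie_add, smul_lie, lie_smul, lie_kbasis]
  simp
  module

end Field

end Heisenberg

/-! ### Automorphisms as matrices -/

namespace Heisenberg

section Field

variable {K : Type*} [Field K]

/-- The matrix of an automorphism, acting on row vectors. -/
def mat (g : LieAut K (K ⊗[ℤ] Heisenberg)) : Matrix (Fin 3) (Fin 3) K :=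
  Matrix.of fun i j => (kbasis K).repr (g (kbasis K i)) j

lemma repr_apply (g : LieAut K (K ⊗[ℤ] Heisenberg)) (v : K ⊗[ℤ] Heisenberg) (j : Fin 3) :
    (kbasis K).repr (g v) j = ∑ i, (kbasis K).repr v i * mat g i j := by
  have h : g v = ∑ i, (kbasis K).repr v i • g (kbasis K i) := by
    conv_lhs => rw [← (kbasis K).sum_repr v]
    refine (map_sum g.toLieEquiv _ _).trans (Finset.sum_congr rfl fun i _ => ?_)
    exact map_smul g.toLieEquiv _ _
  rw [h, map_sum, Finsupp.finsetSum_apply]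
  simp [mat]

lemma mat_mul (g h : LieAut K (K ⊗[ℤ] Heisenberg)) : mat (g * h) = mat g * mat h := by
  ext i j
  rw [Matrix.mul_apply]
  exact repr_apply h (g (kbasis K i)) j

lemma mat_one : mat (1 : LieAut K (K ⊗[ℤ] Heisenberg)) = 1 := by
  ext i j
  simp [mat, LieAut.one_apply, Finsupp.single_apply, Matrix.one_apply]

lemma mat_injective : Function.Injective (mat : LieAut K (K ⊗[ℤ] Heisenberg) → _) := by
  intro g h e
  ext v
  refine (kbasis K).ext_elem fun j => ?_
  rw [repr_apply, repr_apply, e]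

/-- The third basis vector is the bracket of the first two, so its image is governed by the
determinant of the action modulo the centre. -/
lemma apply_kbasis_two (g : LieAut K (K ⊗[ℤ] Heisenberg)) :
    g (kbasis K 2) = (mat g 0 0 * mat g 1 1 - mat g 0 1 * mat g 1 0) • kbasis K 2 := by
  have h : kbasis K 2 = ⁅kbasis K 0, kbasis K 1⁆ := by
    rw [lie_kbasis]
    simp
  conv_lhs => rw [h]
  refine (LieEquiv.map_lie g.toLieEquiv _ _).trans ?_
  rw [lie_eq]
  rfl

lemma mat_two_zero (g : LieAut K (K ⊗[ℤ] Heisenberg)) : mat g 2 0 = 0 := by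
  simp [mat, apply_kbasis_two]

lemma mat_two_one (g : LieAut K (K ⊗[ℤ] Heisenberg)) : mat g 2 1 = 0 := by
  simp [mat, apply_kbasis_two]

lemma mat_two_two (g : LieAut K (K ⊗[ℤ] Heisenberg)) :
    mat g 2 2 = mat g 0 0 * mat g 1 1 - mat g 0 1 * mat g 1 0 := by
  conv_lhs => rw [mat, Matrix.of_apply, apply_kbasis_two]
  simp

/-- The block modulo the centre and the action on the centre each contribute one factor `mat g 2 2`.
Invertibility is thus controlled by this single entry. -/
lemma det_mat (g : LieAut K (K ⊗[ℤ] Heisenberg)) : (mat g).det = mat g 2 2 ^ 2 := by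
  rw [Matrix.det_fin_three, mat_two_zero, mat_two_one, mat_two_two]
  ring

lemma mat_two_two_ne_zero (g : LieAut K (K ⊗[ℤ] Heisenberg)) : mat g 2 2 ≠ 0 := by
  intro h
  have h1 := congrArg Matrix.det (mat_mul g g⁻¹)
  rw [Matrix.det_mul, det_mat g, h, mul_inv_cancel, mat_one] at h1
  simp at h1

/-- The matrix of the automorphism with `e₀ ↦ (a, b, u)` and `e₁ ↦ (c, d, v)`. -/
def autMatrix {R : Type*} [CommRing R] (a b c d u v : R) : Matrix (Fin 3) (Fin 3) R :=
  !![a, b, u; c, d, v; 0, 0, a * d - b * c]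

lemma exists_mat_eq (a b c d u v : K) (h : a * d - b * c ≠ 0) :
    ∃ g : LieAut K (K ⊗[ℤ] Heisenberg), mat g = autMatrix a b c d u v := by
  set M := autMatrix a b c d u v with hM
  have hdet : IsUnit M.transpose.det := by
    rw [Matrix.det_transpose, hM, autMatrix, Matrix.det_fin_three, isUnit_iff_ne_zero]
    intro h0
    apply mul_ne_zero h h
    simp at h0
    linear_combination h0
  -- The transpose appears because `Matrix.toLinearEquiv` acts on column vectors, whereas `mat` acts
  -- on rows.
  let e : K ⊗[ℤ] Heisenberg ≃ₗ[K] K ⊗[ℤ] Heisenberg :=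
    Matrix.toLinearEquiv (kbasis K) M.transpose hdet
  have he : ∀ x j, (kbasis K).repr (e x) j = ∑ i, (kbasis K).repr x i * M i j := by
    intro x j
    have h1 := congrFun (Matrix.repr_toLin (kbasis K) (kbasis K) M.transpose x) j
    refine h1.trans ?_
    simp only [Matrix.mulVec, dotProduct, Matrix.transpose_apply]
    exact Finset.sum_congr rfl fun i _ => mul_comm _ _
  have he2 : e (kbasis K 2) = (a * d - b * c) • kbasis K 2 := by
    refine (kbasis K).ext_elem fun j => ?_
    rw [he, Fin.sum_univ_three]
    fin_cases j <;> simp [hM, autMatrix]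
  refine ⟨⟨{ e with map_lie' := fun {x y} => ?_ }⟩, ?_⟩
  · show e ⁅x, y⁆ = ⁅e x, e y⁆
    rw [lie_eq, lie_eq, map_smul, he2, smul_smul]
    congr 1
    simp only [he, Fin.sum_univ_three]
    simp [hM, autMatrix]
    ring
  · ext i j
    refine (he _ j).trans ?_
    simp [Finsupp.single_apply]

/-- Over a ring of integers `R` of `K`, the lattice consists of the vectors with coordinates in
`R`. -/
lemma mem_lattice_iff {R : Type*} [CommRing R] [Algebra R K] (x : K ⊗[ℤ] Heisenberg) :
    x ∈ LieAut.lattice R K Heisenberg ↔ ∀ j, (kbasis K).repr x j ∈ (algebraMap R K).range := by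
  constructor
  · intro hx j
    induction hx using Submodule.span_induction with
    | mem v hv =>
      obtain ⟨y, rfl⟩ := hv
      rw [kbasis_repr_tmul, one_mul]
      exact intCast_mem _ _
    | zero => simp
    | add v w _ _ hv hw =>
      rw [map_add, Finsupp.add_apply]
      exact add_mem hv hw
    | smul r v _ hv =>
      rw [← algebraMap_smul K r v, map_smul, Finsupp.smul_apply, smul_eq_mul]
      exact mul_mem ⟨r, rfl⟩ hv
  · intro h
    rw [← (kbasis K).sum_repr x]
    refine Submodule.sum_mem _ fun j _ => ?_
    obtain ⟨r, hr⟩ := h j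
    rw [← hr, algebraMap_smul, kbasis_apply]
    exact Submodule.smul_mem _ _ (Submodule.subset_span ⟨_, rfl⟩)

lemma mem_delta_iff {R : Type*} [CommRing R] [Algebra R K] (g : LieAut K (K ⊗[ℤ] Heisenberg)) :
    g ∈ LieAut.Delta R K Heisenberg ↔ ∀ i j, mat g i j ∈ (algebraMap R K).range := by
  constructor
  · intro hg i
    refine (mem_lattice_iff (R := R) (g (kbasis K i))).1 (hg _ ?_)
    rw [kbasis_apply]
    exact Submodule.subset_span ⟨_, rfl⟩
  · intro h x hx
    rw [mem_lattice_iff] at hx ⊢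
    intro j
    rw [repr_apply]
    exact sum_mem fun i _ => mul_mem (hx i) (h i j)

/-- The determinant is `r ^ 2`, a unit of `R`, so the inverse matrix again has entries in `R`. -/
lemma mem_gamma_of_isUnit {R : Type*} [CommRing R] [Algebra R K] [FaithfulSMul R K]
    {g : LieAut K (K ⊗[ℤ] Heisenberg)} (hg : g ∈ LieAut.Delta R K Heisenberg) {r : R}
    (hr : IsUnit r) (hgr : mat g 2 2 = algebraMap R K r) : g ∈ LieAut.Gamma R K Heisenberg := by
  refine ⟨hg, (mem_delta_iff _).2 ?_⟩
  choose N hN using (mem_delta_iff g).1 hg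
  have hmap : (algebraMap R K).mapMatrix (Matrix.of N) = mat g := by
    ext i j
    exact hN i j
  have hdet : IsUnit (Matrix.of N).det := by
    have h1 : algebraMap R K (Matrix.of N).det = algebraMap R K (r ^ 2) := by
      rw [RingHom.map_det, hmap, det_mat, hgr, map_pow]
    rw [FaithfulSMul.algebraMap_injective R K h1]
    exact hr.pow 2
  have h2 : mat g * (algebraMap R K).mapMatrix (Matrix.of N)⁻¹ = 1 := by
    rw [← hmap, ← map_mul, Matrix.mul_nonsing_inv _ hdet, map_one]
  have h3 : mat g⁻¹ * mat g = 1 := by rw [← mat_mul, inv_mul_cancel, mat_one]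
  have h4 : mat g⁻¹ = (algebraMap R K).mapMatrix (Matrix.of N)⁻¹ := by
    rw [← mul_one (mat g⁻¹), ← h2, ← mul_assoc, h3, one_mul]
  intro i j
  rw [h4]
  exact ⟨_, rfl⟩

lemma repr_scalarMap {K' : Type*} [Field K'] [Algebra K K'] (v : K ⊗[ℤ] Heisenberg) (j : Fin 3) :
    (kbasis K').repr (LieAut.scalarMap K K' Heisenberg v) j =
      algebraMap K K' ((kbasis K).repr v j) := by
  induction v with
  | zero => simp
  | tmul a x => rw [LieAut.scalarMap_tmul, kbasis_repr_tmul, kbasis_repr_tmul, map_mul, map_intCast]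
  | add v w hv hw => simp only [map_add, Finsupp.add_apply, hv, hw]

lemma mat_extendScalars {K' : Type*} [Field K'] [Algebra K K']
    (g : LieAut K (K ⊗[ℤ] Heisenberg)) (i j : Fin 3) :
    mat (LieAut.extendScalars K' g) i j = algebraMap K K' (mat g i j) := by
  have h : LieAut.extendScalars K' g (kbasis K' i) =
      LieAut.scalarMap K K' Heisenberg (g (kbasis K i)) := by
    rw [kbasis_apply, kbasis_apply]
    exact (LieAut.extendLinear_tmul K' _ _ _).trans (one_smul _ _)
  rw [mat, Matrix.of_apply, h, repr_scalarMap]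
  rfl

end Field

end Heisenberg

/-! ### Integrality and approximation by rational numbers -/

/-- A rational number that is integral at all primes is an integer. -/
lemma Rat.mem_range_of_forall_norm_le_one (r : ℚ) (h : ∀ p : Nat.Primes, ‖(r : ℚ_[p])‖ ≤ 1) :
    r ∈ (algebraMap ℤ ℚ).range := by
  by_cases hd : r.den = 1
  · exact ⟨r.num, Rat.coe_int_num_of_den_eq_one hd⟩
  · exfalso
    obtain ⟨p, hp, hpd⟩ := Nat.exists_prime_and_dvd hd
    have : Fact p.Prime := ⟨hp⟩
    have h1 : ‖(r.den : ℚ_[p])‖ < 1 := Padic.norm_natCast_lt_one_iff.2 hpd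
    have h2 : ‖(r.num : ℚ_[p])‖ = 1 := by
      rw [Padic.norm_intCast_eq_one_iff]
      refine IsCoprime.of_isCoprime_of_dvd_left (y := (r.num.natAbs : ℤ))
        (Nat.isCoprime_iff_coprime.2 ?_) (by simp)
      exact r.reduced.coprime_dvd_right hpd
    have h3 : (r : ℚ_[p]) * (r.den : ℚ_[p]) = (r.num : ℚ_[p]) := by
      exact_mod_cast congrArg (fun x : ℚ => (x : ℚ_[p])) (Rat.mul_den_eq_num r)
    have h4 := congrArg norm h3
    rw [norm_mul, h2] at h4
    have h5 := h ⟨p, hp⟩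
    have h6 : ‖(r : ℚ_[p])‖ * ‖(r.den : ℚ_[p])‖ ≤ ‖(r.den : ℚ_[p])‖ :=
      mul_le_of_le_one_left (norm_nonneg _) h5
    linarith

lemma Padic.mem_range_algebraMap_iff {p : ℕ} [Fact p.Prime] (x : ℚ_[p]) :
    x ∈ (algebraMap ℤ_[p] ℚ_[p]).range ↔ ‖x‖ ≤ 1 := by
  constructor
  · rintro ⟨y, rfl⟩
    exact y.2
  · intro h
    exact ⟨⟨x, h⟩, rfl⟩

lemma Padic.norm_prime_of_ne {p q : ℕ} [hp : Fact p.Prime] [hq : Fact q.Prime] (h : q ≠ p) :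
    ‖(p : ℚ_[q])‖ = 1 :=
  Padic.norm_natCast_eq_one_iff.2 ((Nat.coprime_primes hq.1 hp.1).2 h)

/-- Strong approximation for `ℤ[1/p]` in `ℚ_p`. -/
lemma Padic.exists_rat_norm_mul_add_le_one {p : ℕ} [hp : Fact p.Prime] {x : ℚ_[p]} (hx : x ≠ 0) (y : ℚ_[p]) :
    ∃ r : ℚ, (∀ q : Nat.Primes, (q : ℕ) ≠ p → ‖(r : ℚ_[q])‖ ≤ 1) ∧ ‖x * r + y‖ ≤ 1 := by
  have hp1 : (1 : ℝ) < p := by exact_mod_cast hp.1.one_lt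
  have hp0 : (p : ℚ_[p]) ≠ 0 := by exact_mod_cast hp.1.ne_zero
  -- The exact solution of `x * r + y = 0` is `-y / x`. A power of `p` clears its denominator, and
  -- the resulting element of `ℤ_p` is then approximated by a natural number `m`, giving `r = m / p
  -- ^ n`.
  obtain ⟨n, hn⟩ := pow_unbounded_of_one_lt ‖y / x‖ hp1
  have hw : ‖-((p : ℚ_[p]) ^ n * (y / x))‖ ≤ 1 := by
    rw [norm_neg, norm_mul, norm_pow, Padic.norm_p, inv_pow, inv_mul_le_iff₀ (by positivity),
      mul_one]
    exact hn.le
  -- With this tolerance the error has norm at most 1 after multiplication by `x / p ^ n`.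
  have hε : 0 < ‖(p : ℚ_[p]) ^ n‖ / ‖x‖ :=
    div_pos (norm_pos_iff.2 (pow_ne_zero _ hp0)) (norm_pos_iff.2 hx)
  obtain ⟨w, hw⟩ : ∃ w : ℤ_[p], (w : ℚ_[p]) = -((p : ℚ_[p]) ^ n * (y / x)) := ⟨⟨_, hw⟩, rfl⟩
  obtain ⟨m, hm⟩ := PadicInt.denseRange_natCast.exists_dist_lt w hε
  refine ⟨m / (p : ℚ) ^ n, fun q hq => ?_, ?_⟩
  · push_cast
    rw [norm_div, norm_pow, Padic.norm_prime_of_ne hq, one_pow, div_one]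
    exact_mod_cast Padic.norm_int_le_one (m : ℤ)
  · rw [dist_eq_norm, PadicInt.norm_def, lt_div_iff₀ (norm_pos_iff.2 hx), ← norm_mul] at hm
    push_cast [hw] at hm ⊢
    have e : x * (m / (p : ℚ_[p]) ^ n) + y =
        -((-((p : ℚ_[p]) ^ n * (y / x)) - m) * x / (p : ℚ_[p]) ^ n) := by
      field_simp
      ring
    rw [e, norm_neg, norm_div]
    exact div_le_one_of_le₀ hm.le (norm_nonneg _)

/-- A power of `p` cancels the valuation of `x` and is a unit at every other prime. -/
lemma Padic.exists_rat_norm_mul_eq_one {p : ℕ} [hp : Fact p.Prime] {x : ℚ_[p]} (hx : x ≠ 0) :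
    ∃ r : ℚ, r ≠ 0 ∧ (∀ q : Nat.Primes, (q : ℕ) ≠ p → ‖(r : ℚ_[q])‖ = 1) ∧ ‖x * r‖ = 1 := by
  have hp0 : (p : ℚ) ≠ 0 := by exact_mod_cast hp.1.ne_zero
  refine ⟨(p : ℚ) ^ (-x.valuation), zpow_ne_zero _ hp0, fun q hq => ?_, ?_⟩
  · push_cast
    rw [norm_zpow, Padic.norm_prime_of_ne hq, one_zpow]
  · push_cast
    rw [norm_mul, norm_zpow, Padic.norm_p, Padic.norm_eq_zpow_neg_valuation hx, inv_zpow, zpow_neg,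
      inv_inv]
    exact inv_mul_cancel₀ (zpow_ne_zero _ (by exact_mod_cast hp.1.ne_zero))

/-! ### The local-global principle for the Heisenberg Lie algebra -/

namespace Heisenberg

open LieAut

lemma mem_delta_padic_iff {p : ℕ} [Fact p.Prime] (g : LieAut ℚ_[p] (ℚ_[p] ⊗[ℤ] Heisenberg)) :
    g ∈ Delta ℤ_[p] ℚ_[p] Heisenberg ↔ ∀ i j, ‖mat g i j‖ ≤ 1 := by
  simp only [mem_delta_iff, Padic.mem_range_algebraMap_iff]

lemma mem_gamma_padic {p : ℕ} [Fact p.Prime] {g : LieAut ℚ_[p] (ℚ_[p] ⊗[ℤ] Heisenberg)}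
    (h : ∀ i j, ‖mat g i j‖ ≤ 1) (hd : ‖mat g 2 2‖ = 1) : g ∈ Gamma ℤ_[p] ℚ_[p] Heisenberg :=
  mem_gamma_of_isUnit ((mem_delta_padic_iff g).2 h) (r := ⟨mat g 2 2, h 2 2⟩)
    (PadicInt.isUnit_iff.2 hd) rfl

lemma forall_norm_autMatrix_le {p : ℕ} [Fact p.Prime] {a b c d u v : ℚ_[p]} (ha : ‖a‖ ≤ 1)
    (hb : ‖b‖ ≤ 1) (hc : ‖c‖ ≤ 1) (hd : ‖d‖ ≤ 1) (hu : ‖u‖ ≤ 1) (hv : ‖v‖ ≤ 1)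
    (hD : ‖a * d - b * c‖ ≤ 1) (i j : Fin 3) : ‖autMatrix a b c d u v i j‖ ≤ 1 := by
  fin_cases i <;> fin_cases j <;> simp [autMatrix, *]

/-- A rational matrix entry is an integer exactly when it is integral at every prime. -/
lemma mem_delta_global_iff (g : LieAut ℚ (ℚ ⊗[ℤ] Heisenberg)) : g ∈ Delta ℤ ℚ Heisenberg ↔
    ∀ p : Nat.Primes, extendScalars ℚ_[p] g ∈ Delta ℤ_[p] ℚ_[p] Heisenberg := by
  simp only [mem_delta_padic_iff, mat_extendScalars, eq_ratCast]
  rw [mem_delta_iff]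
  constructor
  · intro h p i j
    obtain ⟨n, hn⟩ := h i j
    rw [← hn]
    simpa using Padic.norm_int_le_one n
  · intro h i j
    exact Rat.mem_range_of_forall_norm_le_one _ fun p => h p i j

/-- Up to `Γ_p` on the left, an automorphism over `ℚ_p` is upper triangular. -/
lemma exists_gamma_mul_upper {p : ℕ} [Fact p.Prime] (g : LieAut ℚ_[p] (ℚ_[p] ⊗[ℤ] Heisenberg)) :
    ∃ γ ∈ Gamma ℤ_[p] ℚ_[p] Heisenberg, mat (γ * g) 1 0 = 0 := by
  -- In the first column the entry of larger norm divides the other in `ℤ_p`, so one row operation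
  -- clears an entry, combined with a swap of the rows in the second case.
  rcases le_or_gt ‖mat g 1 0‖ ‖mat g 0 0‖ with hle | hlt
  · have h0 : mat g 0 0 ≠ 0 := by
      intro h0
      rw [h0, norm_zero, norm_le_zero_iff] at hle
      apply mat_two_two_ne_zero g
      rw [mat_two_two, h0, hle]
      ring
    have hn : ‖-(mat g 1 0 / mat g 0 0)‖ ≤ 1 := by
      rw [norm_neg, norm_div]
      exact div_le_one_of_le₀ hle (norm_nonneg _)
    obtain ⟨γ, hγ⟩ := exists_mat_eq (1 : ℚ_[p]) 0 (-(mat g 1 0 / mat g 0 0)) 1 0 0 (by simp)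
    refine ⟨γ, mem_gamma_padic ?_ ?_, ?_⟩
    · rw [hγ]
      exact forall_norm_autMatrix_le (by simp) (by simp) hn (by simp) (by simp) (by simp) (by simp)
    · rw [hγ]
      simp [autMatrix]
    · rw [mat_mul, Matrix.mul_apply, Fin.sum_univ_three, hγ]
      simp only [autMatrix, Matrix.of_apply, Matrix.cons_val]
      field_simp
      ring
  · have h0 : mat g 1 0 ≠ 0 := fun h0 => by
      rw [h0, norm_zero] at hlt
      exact absurd hlt (not_lt.2 (norm_nonneg _))
    have hn : ‖-(mat g 0 0 / mat g 1 0)‖ ≤ 1 := by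
      rw [norm_neg, norm_div]
      exact div_le_one_of_le₀ hlt.le (norm_nonneg _)
    obtain ⟨γ, hγ⟩ := exists_mat_eq (0 : ℚ_[p]) 1 1 (-(mat g 0 0 / mat g 1 0)) 0 0 (by simp)
    refine ⟨γ, mem_gamma_padic ?_ ?_, ?_⟩
    · rw [hγ]
      exact forall_norm_autMatrix_le (by simp) (by simp) (by simp) hn (by simp) (by simp) (by simp)
    · rw [hγ]
      simp [autMatrix]
    · rw [mat_mul, Matrix.mul_apply, Fin.sum_univ_three, hγ]
      simp only [autMatrix, Matrix.of_apply, Matrix.cons_val]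
      field_simp
      ring

/-- An upper triangular automorphism over `ℚ_p` is inverse, up to `Γ_p` on the left, to a global
automorphism that lies in `Γ_q` for all primes `q ≠ p`. -/
lemma exists_global_of_upper (p : Nat.Primes) (g : LieAut ℚ_[p] (ℚ_[p] ⊗[ℤ] Heisenberg))
    (hg : mat g 1 0 = 0) : ∃ h : LieAut ℚ (ℚ ⊗[ℤ] Heisenberg),
      (∀ q : Nat.Primes, q ≠ p → extendScalars ℚ_[q] h ∈ Gamma ℤ_[q] ℚ_[q] Heisenberg) ∧
      g * extendScalars ℚ_[p] h ∈ Gamma ℤ_[p] ℚ_[p] Heisenberg := by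
  have hD := mat_two_two_ne_zero g
  have hD' := mat_two_two g
  rw [hg, mul_zero, sub_zero] at hD'
  rw [hD'] at hD
  have ha := left_ne_zero_of_mul hD
  have hd := right_ne_zero_of_mul hD
  -- The entries of `h` are chosen so that the product `g h` is integral: `α` and `δ` make its
  -- diagonal entries units, then `r` corrects the off-diagonal entry. Of the translation entries
  -- `t` comes before `s`, because `t` enters the condition on `s`.
  obtain ⟨α, hα0, hα, hk⟩ := Padic.exists_rat_norm_mul_eq_one ha
  obtain ⟨δ, hδ0, hδ, hl⟩ := Padic.exists_rat_norm_mul_eq_one hd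
  obtain ⟨r, hr, hr'⟩ := Padic.exists_rat_norm_mul_add_le_one ha (mat g 0 1 * δ)
  obtain ⟨t, ht, ht'⟩ := Padic.exists_rat_norm_mul_add_le_one hd (mat g 1 2 * (α * δ))
  obtain ⟨s, hs, hs'⟩ := Padic.exists_rat_norm_mul_add_le_one ha
    (mat g 0 1 * t + mat g 0 2 * (α * δ))
  have hαδ : α * δ - r * 0 ≠ 0 := by
    rw [mul_zero, sub_zero]
    exact mul_ne_zero hα0 hδ0
  obtain ⟨h, hh⟩ := exists_mat_eq α r 0 δ s t hαδ
  refine ⟨h, fun q hq => ?_, ?_⟩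
  · have hq' : (q : ℕ) ≠ p := fun e => hq (Subtype.ext e)
    have hm : mat (extendScalars ℚ_[q] h) = autMatrix (α : ℚ_[q]) r 0 δ s t := by
      ext i j
      rw [mat_extendScalars, hh]
      fin_cases i <;> fin_cases j <;> simp [autMatrix]
    have hdet : ‖(α : ℚ_[q]) * δ - r * 0‖ = 1 := by
      rw [mul_zero, sub_zero, norm_mul, hα q hq', hδ q hq', one_mul]
    refine mem_gamma_padic ?_ ?_
    · rw [hm]
      exact forall_norm_autMatrix_le (hα q hq').le (hr q hq') (by simp) (hδ q hq').le (hs q hq')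
        (ht q hq') hdet.le
    · rw [hm]
      exact hdet
  · have hm : mat (g * extendScalars ℚ_[p] h) = autMatrix (mat g 0 0 * α)
        (mat g 0 0 * r + mat g 0 1 * δ) 0 (mat g 1 1 * δ)
        (mat g 0 0 * s + (mat g 0 1 * t + mat g 0 2 * (α * δ)))
        (mat g 1 1 * t + mat g 1 2 * (α * δ)) := by
      ext i j
      rw [mat_mul, Matrix.mul_apply, Fin.sum_univ_three, mat_extendScalars, mat_extendScalars,
        mat_extendScalars, hh]
      fin_cases i <;> fin_cases j <;>
        simp [autMatrix, hg, mat_two_zero, mat_two_one, hD'] <;> ring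
    have hdet : ‖mat g 0 0 * α * (mat g 1 1 * δ)‖ = 1 := by
      rw [norm_mul, hk, hl, one_mul]
    refine mem_gamma_padic ?_ ?_
    · rw [hm]
      exact forall_norm_autMatrix_le hk.le hr' (by simp) hl.le hs' ht' (by
        rw [mul_zero, sub_zero]
        exact hdet.le)
    · rw [hm]
      simpa [autMatrix] using hdet

/-- For `exists_global`, if `γ g h` lies in `Γ_p` then `h⁻¹` and `g` differ on the left by an
element of `Γ_p`; so the global representative of the coset of `g` is `h⁻¹`. -/
lemma hasLocalGlobal : HasLocalGlobal Heisenberg where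
  mem_gamma_iff g := by
    refine (and_congr (mem_delta_global_iff g) (mem_delta_global_iff g⁻¹)).trans ?_
    simp only [map_inv]
    exact forall_and.symm
  mem_delta_iff := mem_delta_global_iff
  mem_local_iff _ _ := Iff.rfl
  exists_global p g := by
    obtain ⟨γ, hγ, h0⟩ := exists_gamma_mul_upper g
    obtain ⟨h, h1, h2⟩ := exists_global_of_upper p (γ * g) h0
    refine ⟨h⁻¹, fun q hq => ?_, ?_⟩
    · rw [map_inv]
      exact inv_mem (h1 q hq)
    · have h3 := mul_mem (inv_mem h2) hγ
      rw [map_inv]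
      simpa [mul_assoc] using h3

/-! ### Two global double cosets that merge at the prime 5 -/

/-- The automorphism with matrix `diag(5, 125)` on the abelianization and translation part
`(1, w)`. -/
lemma exists_delta_mat_eq (w : ℤ) : ∃ ξ ∈ Delta ℤ ℚ Heisenberg,
    mat ξ = autMatrix 5 0 0 125 1 (w : ℚ) := by
  obtain ⟨ξ, hξ⟩ := exists_mat_eq (5 : ℚ) 0 0 125 1 w (by norm_num)
  refine ⟨ξ, (mem_delta_iff ξ).2 fun i j => ⟨autMatrix 5 0 0 125 1 w i j, ?_⟩, hξ⟩
  rw [hξ]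
  fin_cases i <;> fin_cases j <;> norm_num [autMatrix]

/-- `Γ`-double cosets of automorphisms with different translation parts are distinct. -/
lemma notMem_doubleCoset {ξ ξ' : LieAut ℚ (ℚ ⊗[ℤ] Heisenberg)}
    (hξ : mat ξ = autMatrix 5 0 0 125 1 ((5 : ℤ) : ℚ))
    (hξ' : mat ξ' = autMatrix 5 0 0 125 1 ((10 : ℤ) : ℚ)) :
    ξ' ∉ DoubleCoset.doubleCoset ξ (Gamma ℤ ℚ Heisenberg) (Gamma ℤ ℚ Heisenberg) := by
  rw [DoubleCoset.mem_doubleCoset]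
  rintro ⟨P, hP, Q, hQ, e⟩
  -- Moving `P` to the other side makes the relation linear in the integral entries of both unknown
  -- matrices.
  have e' : P⁻¹ * ξ' = ξ * Q := by
    rw [e]
    group
  choose M hM using (mem_delta_iff P⁻¹).1 hP.2
  choose M' hM' using (mem_delta_iff P).1 hP.1
  choose N hN using (mem_delta_iff Q).1 hQ.1
  have hMD : M 2 2 = M 0 0 * M 1 1 - M 0 1 * M 1 0 := by
    have := mat_two_two P⁻¹
    rw [← hM, ← hM, ← hM, ← hM, ← hM] at this
    exact_mod_cast this
  have hunit : M 2 2 = 1 ∨ M 2 2 = -1 := by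
    have h1 := congrFun (congrFun (mat_mul P⁻¹ P) 2) 2
    rw [inv_mul_cancel, mat_one, Matrix.mul_apply, Fin.sum_univ_three, mat_two_zero, mat_two_one,
      ← hM 2 2, ← hM' 2 2] at h1
    have h2 : M 2 2 * M' 2 2 = 1 := by
      simp at h1
      exact_mod_cast h1.symm
    exact Int.eq_one_or_neg_one_of_mul_eq_one h2
  have hent : ∀ i j, (mat P⁻¹ * mat ξ') i j = (mat ξ * mat Q) i j := fun i j => by
    rw [← mat_mul, ← mat_mul, e']
  simp only [Matrix.mul_apply, Fin.sum_univ_three, hξ, hξ', ← hM, ← hN] at hent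
  have h10 := hent 1 0
  have h02 := hent 0 2
  have h12 := hent 1 2
  have h22 := hent 2 2
  have z20 := mat_two_zero P⁻¹
  have z21 := mat_two_one P⁻¹
  have y20 := mat_two_zero Q
  rw [← hM] at z20 z21
  rw [← hN] at y20
  simp only [autMatrix, Matrix.of_apply, Matrix.cons_val, eq_intCast] at h10 h02 h12 h22 z20 z21 y20
  rw [z20, z21] at h22
  rw [y20] at h10
  norm_num at h10 h02 h12 h22
  have h10' : M 1 0 * 5 = 125 * N 1 0 := by exact_mod_cast h10
  have h02' : M 0 0 + M 0 1 * 10 + M 0 2 * 625 = 5 * N 0 2 + N 2 2 := by exact_mod_cast h02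
  have h12' : M 1 0 + M 1 1 * 10 + M 1 2 * 625 = 125 * N 1 2 + 5 * N 2 2 := by exact_mod_cast h12
  have h22' : M 2 2 = N 2 2 := by
    have : M 2 2 * 625 = 625 * N 2 2 := by exact_mod_cast h22
    omega
  -- Here `M 1 0` is divisible by 25 by `h10'`, so `h12'` can be divided by 5 and then reduced
  -- modulo 5; the coefficient 2 is `10 / 5`.
  have hx : M 0 0 ≡ M 2 2 [ZMOD 5] := by
    unfold Int.ModEq
    omega
  have hw : 2 * M 1 1 ≡ M 2 2 [ZMOD 5] := by
    unfold Int.ModEq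
    omega
  have hz : M 1 0 ≡ 0 [ZMOD 5] := by
    unfold Int.ModEq
    omega
  -- With `D = M 2 2`, multiplying the two congruences gives `2 D ≡ D²` modulo 5, that is `D ≡ 2`
  -- for a unit `D`, which excludes `D = ±1`.
  have h1 : 2 * M 2 2 ≡ M 2 2 * M 2 2 [ZMOD 5] := by
    have h2 := (hx.mul hw).sub ((hz.mul_left (M 0 1)).mul_left 2)
    have h3 : M 0 0 * (2 * M 1 1) - 2 * (M 0 1 * M 1 0) = 2 * M 2 2 := by
      rw [hMD]
      ring
    rw [h3] at h2
    simpa using h2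
  rcases hunit with h | h <;> rw [h] at h1 <;> revert h1 <;> decide

/-- At the prime `5` the double cosets of the two automorphisms agree. -/
lemma mem_doubleCoset_five {ξ ξ' : LieAut ℚ (ℚ ⊗[ℤ] Heisenberg)}
    (hξ : mat ξ = autMatrix 5 0 0 125 1 ((5 : ℤ) : ℚ))
    (hξ' : mat ξ' = autMatrix 5 0 0 125 1 ((10 : ℤ) : ℚ)) (p : Nat.Primes) (hp : (p : ℕ) = 5) :
    extendScalars ℚ_[p] ξ' ∈ DoubleCoset.doubleCoset (extendScalars ℚ_[p] ξ)
      (Gamma ℤ_[p] ℚ_[p] Heisenberg) (Gamma ℤ_[p] ℚ_[p] Heisenberg) := by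
  -- These rational automorphisms are not both integral globally, but 2 is a 5-adic unit, so they
  -- lie in `Γ_5`. The outer factors `1 / 2` and `2` cancel everywhere except in the second
  -- translation entry, which is doubled.
  obtain ⟨a, ha⟩ := exists_mat_eq (1 / 2 : ℚ) 0 0 1 0 0 (by norm_num)
  obtain ⟨b, hb⟩ := exists_mat_eq (2 : ℚ) 0 0 1 0 0 (by norm_num)
  have e : ξ' = a * ξ * b := by
    refine mat_injective ?_
    ext i j
    rw [mat_mul, mat_mul, Matrix.mul_apply, Fin.sum_univ_three, Matrix.mul_apply, Matrix.mul_apply,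
      Matrix.mul_apply, Fin.sum_univ_three, Fin.sum_univ_three, Fin.sum_univ_three, ha, hb, hξ, hξ']
    fin_cases i <;> fin_cases j <;> simp [autMatrix] <;> norm_num
  have h2 : ‖(2 : ℚ_[p])‖ = 1 := by
    have := (Padic.norm_natCast_eq_one_iff (p := p) (n := 2)).2 (by rw [hp]; decide)
    exact_mod_cast this
  rw [e, map_mul, map_mul]
  refine DoubleCoset.mem_doubleCoset.2 ⟨_, mem_gamma_padic ?_ ?_, _, mem_gamma_padic ?_ ?_, rfl⟩
  · intro i j
    rw [mat_extendScalars, ha]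
    fin_cases i <;> fin_cases j <;> simp [autMatrix, h2]
  · rw [mat_extendScalars, ha]
    simp [autMatrix, h2]
  · intro i j
    rw [mat_extendScalars, hb]
    fin_cases i <;> fin_cases j <;> simp [autMatrix, h2]
  · rw [mat_extendScalars, hb]
    simp [autMatrix, h2]

/-- The automorphisms of `exists_delta_mat_eq` lie in `Γ_q` for all primes `q ≠ 5`. -/
lemma mem_gamma_of_ne_five {ξ : LieAut ℚ (ℚ ⊗[ℤ] Heisenberg)} {w : ℤ}
    (hξΔ : ξ ∈ Delta ℤ ℚ Heisenberg) (hξ : mat ξ = autMatrix 5 0 0 125 1 (w : ℚ)) (q : Nat.Primes)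
    (hq : (q : ℕ) ≠ 5) : extendScalars ℚ_[q] ξ ∈ Gamma ℤ_[q] ℚ_[q] Heisenberg := by
  refine mem_gamma_padic ((mem_delta_padic_iff _).1 ((mem_delta_global_iff ξ).1 hξΔ q)) ?_
  -- The determinant `5 * 125 = 5 ^ 4` is a unit at every prime other than 5.
  have h5 : ‖((5 ^ 4 : ℕ) : ℚ_[q])‖ = 1 :=
    Padic.norm_natCast_eq_one_iff.2 (((Nat.coprime_primes q.2 (by norm_num)).2 hq).pow_right 4)
  rw [mat_extendScalars, hξ, ← h5]
  congr 1
  simp [autMatrix]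
  norm_num

end Heisenberg

end

theorem theorem4p6 :
    ∃ φ : ∀ p : Nat.Primes,
        LieAut.LocalHeckeRing Heisenberg p →+* LieAut.GlobalHeckeRing Heisenberg,
      -- each local Hecke ring embeds into the global one by `η^*`
      (∀ p x, φ p x = LieAut.etaStar Heisenberg (LieAut.localMap Heisenberg p x)) ∧
      (∀ p, Function.Injective (φ p)) ∧
      -- the local Hecke rings commute with each other
      (∀ p q, p ≠ q → ∀ x y, Commute (φ p x) (φ q y)) ∧
      -- the local Hecke rings do not generate the global one as a ring
      (⨆ p, (φ p).range) ≠ ⊤ := by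
  have h := Heisenberg.hasLocalGlobal
  refine ⟨fun p => HeckePair.IsLocalGlobal.localHom h p,
    fun p x => LieAut.localHom_eq_etaStar h p x,
    fun p => HeckePair.IsLocalGlobal.localHom_injective h p,
    fun p q hpq x y => HeckePair.IsLocalGlobal.commute_localHom h hpq x y, ?_⟩
  -- The two translation parts differ by the factor 2, a unit at 5 that is not congruent to `±1`
  -- modulo 5. At the primes 2 and 3 every unit is `±1` modulo the prime.
  obtain ⟨ξ, hξΔ, hξ⟩ := Heisenberg.exists_delta_mat_eq 5
  obtain ⟨ξ', hξΔ', hξ'⟩ := Heisenberg.exists_delta_mat_eq 10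
  exact HeckePair.IsLocalGlobal.iSup_range_localHom_ne_top h (p := ⟨5, by norm_num⟩) hξΔ
    (fun q hq => Heisenberg.mem_gamma_of_ne_five hξΔ hξ q fun e => hq (Subtype.ext e))
    (fun q hq => Heisenberg.mem_gamma_of_ne_five hξΔ' hξ' q fun e => hq (Subtype.ext e))
    (Heisenberg.mem_doubleCoset_five hξ hξ' _ rfl) (Heisenberg.notMem_doubleCoset hξ hξ')
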